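/- Let ${\sf N}\subset\mathbb{C}^4$ be the $5$-dimensional real submanifold defined, in the coordinates $(z,w_1,w_2,w_3)$, by $$w_1=\overline{w_1}+2i\,z\bar z,\qquad w_2=\overline{w_2}+2i\,z\bar z(z+\bar z),\qquad w_3=\overline{w_3}+2i\,z\bar z\left(z^2+\tfrac32 z\bar z+\bar z^2\right),$$ with the CR structure induced from $\mathbb{C}^4$. Let $\mathfrak{aut}_{CR}({\sf N})$ be the real Lie algebra (under the bracket of vector fields) of infinitesimal CR-automorphisms of ${\sf N}$, that is, of smooth real vector fields $X$ on ${\sf N}$ with $[X,\Gamma(T^{1,0}{\sf N})]\subset\Gamma(T^{1,0}{\sf N})$. Then: 1. $\dim_{\mathbb{R}}\mathfrak{aut}_{CR}({\sf N})=6$. 2. The space of complex-valued Maurer–Cartan forms of $\mathfrak{aut}_{CR}({\sf N})$, i.e. of real-linear maps $\mathfrak{aut}_{CR}({\sf N})\to\mathbb{C}$, has a basis over $\mathbb{C}$ consisting of six forms $\tau,\sigma,\rho,\zeta,\overline\zeta,\alpha$, where $\tau,\sigma,\rho,\alpha$ are real-valued and $\overline\zeta$ is the complex conjugate of $\zeta$,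 which satisfy the structure equations $$\begin{aligned} d\tau&=4\,\alpha\wedge\tau+\sigma\wedge\zeta+\sigma\wedge\overline\zeta,\\ d\sigma&=3\,\alpha\wedge\sigma+\rho\wedge\zeta+\rho\wedge\overline\zeta,\\ d\rho&=2\,\alpha\wedge\rho+i\,\zeta\wedge\overline\zeta,\\ d\zeta&=\alpha\wedge\zeta,\\ d\overline\zeta&=\alpha\wedge\overline\zeta,\\ d\alpha&=0,\end{aligned}$$ where $d\omega(X,Y)=-\omega([X,Y])$ and $(\omega\wedge\eta)(X,Y)=\omega(X)\eta(Y)-\omega(Y)\eta(X)$. 3. The same holds locally: for every non-empty connected open subset $U$ of ${\sf N}$, each infinitesimal CR-automorphism of $U$ is the restriction to $U$ of exactly one element of $\mathfrak{aut}_{CR}({\sf N})$. -/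

import Mathlib

open scoped ContDiff ComplexConjugate

namespace CRModel

/-! ### Subsets of `ℂⁿ` as CR manifolds -/

/-- The real tangent space of `M ⊆ ℂⁿ` at `p`: the real span of the tangent directions to `M` at
`p`.  For an embedded submanifold `M` this is the usual tangent space `T_p M`. -/
noncomputable def tangentSp {n : ℕ} (M : Set (Fin n → ℂ)) (p : Fin n → ℂ) : Submodule ℝ (Fin n → ℂ) :=
  Submodule.span ℝ (tangentConeAt ℝ M p)

/-- Multiplication by `i` on `ℂⁿ`, as a real linear map (the complex structure `J`). -/
noncomputable def mulI (n : ℕ) : (Fin n → ℂ) →ₗ[ℝ] (Fin n → ℂ) where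
  toFun v := Complex.I • v
  map_add' v w := smul_add _ v w
  map_smul' c v := smul_comm _ c v

/-- The complex tangent space `T_p M ∩ i T_p M` of `M ⊆ ℂⁿ` at `p`. With multiplication by `i`
it is the CR structure induced on `M`; its complexification is `T^{1,0}_p M ⊕ T^{0,1}_p M`. -/
noncomputable def complexTangentSp {n : ℕ} (M : Set (Fin n → ℂ)) (p : Fin n → ℂ) : Submodule ℝ (Fin n → ℂ) :=
  tangentSp M p ⊓ (tangentSp M p).comap (mulI n)

/-- Smooth real vector fields on `M`. A vector field on `M` is encoded as a map `ℂⁿ → ℂⁿ` that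
is tangent to `M` along `M`, and (so that it is determined by its values on `M`) zero off `M`. -/
structure IsVectorField {n : ℕ} (M : Set (Fin n → ℂ)) (X : (Fin n → ℂ) → (Fin n → ℂ)) : Prop where
  smooth : ContDiffOn ℝ ∞ X M
  tangent : ∀ p ∈ M, X p ∈ tangentSp M p
  zero_off : ∀ p, p ∉ M → X p = 0

/-- Smooth sections of the complex tangent bundle of `M`. -/
structure IsComplexTangentField {n : ℕ} (M : Set (Fin n → ℂ))
    (Y : (Fin n → ℂ) → (Fin n → ℂ)) : Prop extends IsVectorField M Y where
  complex_tangent : ∀ p ∈ M, Y p ∈ complexTangentSp M p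

/-- The Lie bracket of vector fields on `M`; at `p ∈ M` it is `D_p Y (X p) - D_p X (Y p)`, the
derivatives being taken along `M`. -/
noncomputable def bracket {n : ℕ} (M : Set (Fin n → ℂ)) (X Y : (Fin n → ℂ) → (Fin n → ℂ)) :
    (Fin n → ℂ) → (Fin n → ℂ) :=
  M.indicator (VectorField.lieBracketWithin ℝ X Y M)

/-- Infinitesimal CR automorphisms of `M`: the smooth real vector fields `X` on `M` along which
the CR structure is invariant, i.e. `[X, Y]` is a section of the complex tangent bundle and
`[X, J Y] = J [X, Y]`, for all sections `Y` of the complex tangent bundle.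
Equivalently `[X, Γ(T^{1,0}M)] ⊆ Γ(T^{1,0}M)`. -/
structure IsInfCRAut {n : ℕ} (M : Set (Fin n → ℂ)) (X : (Fin n → ℂ) → (Fin n → ℂ)) : Prop
    extends IsVectorField M X where
  bracket_mem : ∀ Y, IsComplexTangentField M Y → ∀ p ∈ M, bracket M X Y p ∈ complexTangentSp M p
  bracket_I : ∀ Y, IsComplexTangentField M Y → ∀ p ∈ M,
    bracket M X (Complex.I • Y) p = Complex.I • bracket M X Y p

section Basic

variable {n : ℕ} {M : Set (Fin n → ℂ)} {p v : Fin n → ℂ}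
  {X Y Z : (Fin n → ℂ) → (Fin n → ℂ)}

theorem fderiv_unique {f : (Fin n → ℂ) → (Fin n → ℂ)} {f' g' : (Fin n → ℂ) →L[ℝ] (Fin n → ℂ)}
    (hf : HasFDerivWithinAt f f' M p) (hg : HasFDerivWithinAt f g' M p)
    (hv : v ∈ tangentSp M p) : f' v = g' v := by
  have h : Set.EqOn f' g' (Submodule.span ℝ (tangentConeAt ℝ M p)) :=
    LinearMap.eqOn_span' (f := (f' : (Fin n → ℂ) →ₗ[ℝ] (Fin n → ℂ))) (g := g')
      (hf.unique_on hg)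
  exact h hv

theorem smul_I_mem (hv : v ∈ complexTangentSp M p) : Complex.I • v ∈ complexTangentSp M p := by
  refine ⟨hv.2, ?_⟩
  have h : mulI n (Complex.I • v) = -v := by
    simp [mulI, smul_smul]
  simpa [h] using hv.1

theorem IsVectorField.diff (hX : IsVectorField M X) (hp : p ∈ M) :
    HasFDerivWithinAt X (fderivWithin ℝ X M p) M p :=
  ((hX.smooth p hp).differentiableWithinAt (by simp)).hasFDerivWithinAt

theorem IsVectorField.add (hX : IsVectorField M X) (hY : IsVectorField M Y) :
    IsVectorField M (X + Y) :=
  ⟨hX.smooth.add hY.smooth, fun p hp => add_mem (hX.tangent p hp) (hY.tangent p hp),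
    fun p hp => by simp [hX.zero_off p hp, hY.zero_off p hp]⟩

theorem IsVectorField.smul (c : ℝ) (hX : IsVectorField M X) : IsVectorField M (c • X) :=
  ⟨contDiffOn_const.smul hX.smooth, fun p hp => Submodule.smul_mem _ c (hX.tangent p hp),
    fun p hp => by simp [hX.zero_off p hp]⟩

theorem isVectorField_zero : IsVectorField M 0 :=
  ⟨contDiffOn_const, fun _ _ => zero_mem _, fun _ _ => rfl⟩

theorem IsComplexTangentField.smul_I (hY : IsComplexTangentField M Y) :
    IsComplexTangentField M (Complex.I • Y) where
  smooth := contDiffOn_const.smul hY.smooth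
  tangent p hp := (smul_I_mem (hY.complex_tangent p hp)).1
  zero_off p hp := by simp [hY.zero_off p hp]
  complex_tangent p hp := smul_I_mem (hY.complex_tangent p hp)

theorem bracket_zero_off (hp : p ∉ M) : bracket M X Y p = 0 := by
  simp [bracket, hp]

theorem bracket_apply (hp : p ∈ M) :
    bracket M X Y p = fderivWithin ℝ Y M p (X p) - fderivWithin ℝ X M p (Y p) := by
  simp [bracket, hp, VectorField.lieBracketWithin]

theorem bracket_swap : bracket M X Y = -bracket M Y X := by
  funext p
  by_cases hp : p ∈ M
  · simp [bracket_apply hp]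
  · simp [bracket_zero_off hp]

theorem bracket_add_left (hX : IsVectorField M X) (hY : IsVectorField M Y)
    (hZ : IsVectorField M Z) : bracket M (X + Y) Z = bracket M X Z + bracket M Y Z := by
  funext p
  by_cases hp : p ∈ M
  · have h := fderiv_unique ((hX.add hY).diff hp) ((hX.diff hp).add (hY.diff hp))
      (hZ.tangent p hp)
    simp only [bracket_apply hp, Pi.add_apply, h, add_apply, map_add]
    abel
  · simp [bracket_zero_off hp]

theorem bracket_smul_left (c : ℝ) (hX : IsVectorField M X) (hZ : IsVectorField M Z) :
    bracket M (c • X) Z = c • bracket M X Z := by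
  funext p
  by_cases hp : p ∈ M
  · have h := fderiv_unique ((hX.smul c).diff hp) ((hX.diff hp).const_smul c)
      (hZ.tangent p hp)
    simp only [bracket_apply hp, Pi.smul_apply, h, smul_apply, map_smul,
      smul_sub]
  · simp [bracket_zero_off hp]

theorem bracket_add_right (hX : IsVectorField M X) (hY : IsVectorField M Y)
    (hZ : IsVectorField M Z) : bracket M X (Y + Z) = bracket M X Y + bracket M X Z := by
  rw [bracket_swap, bracket_add_left hY hZ hX, bracket_swap (X := X) (Y := Y),
    bracket_swap (X := X) (Y := Z)]
  abel

theorem bracket_smul_right (c : ℝ) (hX : IsVectorField M X) (hZ : IsVectorField M Z) :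
    bracket M X (c • Z) = c • bracket M X Z := by
  rw [bracket_swap, bracket_smul_left c hZ hX, bracket_swap (X := X), smul_neg]

end Basic

/-- The real vector space `aut_CR(M)` of infinitesimal CR automorphisms of `M`. -/
def autCR {n : ℕ} (M : Set (Fin n → ℂ)) : Submodule ℝ ((Fin n → ℂ) → (Fin n → ℂ)) where
  carrier := {X | IsInfCRAut M X}
  zero_mem' := by
    have h : ∀ Z : (Fin n → ℂ) → (Fin n → ℂ), bracket M 0 Z = 0 := fun Z => by
      funext p
      by_cases hp : p ∈ M
      · simp [bracket_apply hp]
      · simp [bracket_zero_off hp]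
    refine ⟨isVectorField_zero, ?_, ?_⟩
    · intro Y hY p hp
      simp [h]
    · intro Y hY p hp
      simp [h]
  add_mem' := by
    intro X Y hX hY
    refine ⟨hX.toIsVectorField.add hY.toIsVectorField, ?_, ?_⟩
    · intro Z hZ p hp
      rw [bracket_add_left hX.toIsVectorField hY.toIsVectorField hZ.toIsVectorField]
      exact add_mem (hX.bracket_mem Z hZ p hp) (hY.bracket_mem Z hZ p hp)
    · intro Z hZ p hp
      rw [bracket_add_left hX.toIsVectorField hY.toIsVectorField hZ.toIsVectorField,
        bracket_add_left hX.toIsVectorField hY.toIsVectorField hZ.smul_I.toIsVectorField,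
        Pi.add_apply, Pi.add_apply, hX.bracket_I Z hZ p hp, hY.bracket_I Z hZ p hp, smul_add]
  smul_mem' := by
    intro c X hX
    refine ⟨hX.toIsVectorField.smul c, ?_, ?_⟩
    · intro Z hZ p hp
      rw [bracket_smul_left c hX.toIsVectorField hZ.toIsVectorField]
      exact Submodule.smul_mem _ c (hX.bracket_mem Z hZ p hp)
    · intro Z hZ p hp
      rw [bracket_smul_left c hX.toIsVectorField hZ.toIsVectorField,
        bracket_smul_left c hX.toIsVectorField hZ.smul_I.toIsVectorField,
        Pi.smul_apply, Pi.smul_apply, hX.bracket_I Z hZ p hp, smul_comm]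

/-! ### The Lie algebra structure

If `M` is a smooth retract of `ℂⁿ`, the bracket of vector fields makes `autCR M` a Lie algebra. -/

/-- `r` is a smooth retraction of `ℂⁿ` onto `M`. -/
structure IsRetraction {n : ℕ} (M : Set (Fin n → ℂ)) (r : (Fin n → ℂ) → (Fin n → ℂ)) : Prop where
  smooth : ContDiff ℝ ∞ r
  maps : ∀ x, r x ∈ M
  fix : ∀ x ∈ M, r x = x

section Retract

variable {n : ℕ} {M : Set (Fin n → ℂ)} {p v : Fin n → ℂ}
  {X Y Z : (Fin n → ℂ) → (Fin n → ℂ)} {r : (Fin n → ℂ) → (Fin n → ℂ)}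

theorem two_le_infty : (2 : WithTop ℕ∞) ≤ ∞ := by
  exact WithTop.coe_le_coe.2 (le_top : (2 : ℕ∞) ≤ ⊤)

theorem IsRetraction.contDiff (hr : IsRetraction M r) (hX : IsVectorField M X) :
    ContDiff ℝ ∞ (X ∘ r) :=
  hX.smooth.comp_contDiff hr.smooth hr.maps

theorem fderivWithin_eq_of_eqOn (hX : IsVectorField M X) {G : (Fin n → ℂ) → (Fin n → ℂ)}
    (hG : ContDiff ℝ ∞ G) (h : ∀ x ∈ M, X x = G x) (hp : p ∈ M) (hv : v ∈ tangentSp M p) :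
    fderivWithin ℝ X M p v = fderiv ℝ G p v := by
  have h1 : HasFDerivWithinAt G (fderiv ℝ G p) M p :=
    ((hG.differentiable (by simp)) p).hasFDerivAt.hasFDerivWithinAt
  exact fderiv_unique (hX.diff hp) (h1.congr h (h p hp)) hv

theorem bracket_eq_lieBracket (hX : IsVectorField M X) (hY : IsVectorField M Y)
    {F G : (Fin n → ℂ) → (Fin n → ℂ)} (hF : ContDiff ℝ ∞ F) (hG : ContDiff ℝ ∞ G)
    (hXF : ∀ x ∈ M, X x = F x) (hYG : ∀ x ∈ M, Y x = G x) (hp : p ∈ M) :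
    bracket M X Y p = VectorField.lieBracket ℝ F G p := by
  rw [bracket_apply hp, fderivWithin_eq_of_eqOn hX hF hXF hp (hY.tangent p hp),
    fderivWithin_eq_of_eqOn hY hG hYG hp (hX.tangent p hp), VectorField.lieBracket,
    hXF p hp, hYG p hp]

theorem contDiff_lieBracket {F G : (Fin n → ℂ) → (Fin n → ℂ)} (hF : ContDiff ℝ ∞ F)
    (hG : ContDiff ℝ ∞ G) : ContDiff ℝ ∞ (VectorField.lieBracket ℝ F G) :=
  ContDiff.lieBracket_vectorField hF hG (by simp)

theorem IsRetraction.fderiv_mem (hr : IsRetraction M r) (hp : p ∈ M) (v : Fin n → ℂ) :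
    fderiv ℝ r p v ∈ tangentSp M p := by
  have h1 : HasFDerivWithinAt r (fderiv ℝ r p) Set.univ p :=
    ((hr.smooth.differentiable (by simp)) p).hasFDerivAt.hasFDerivWithinAt
  have h2 : fderiv ℝ r p v ∈ tangentConeAt ℝ (r '' Set.univ) (r p) :=
    h1.mapsTo_tangent_cone (by rw [tangentConeAt_univ]; trivial)
  rw [hr.fix p hp] at h2
  refine Submodule.subset_span (tangentConeAt_mono ?_ h2)
  rintro _ ⟨x, _, rfl⟩
  exact hr.maps x

theorem IsRetraction.fderiv_eq (hr : IsRetraction M r) (hp : p ∈ M) (hv : v ∈ tangentSp M p) :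
    fderiv ℝ r p v = v := by
  have h1 : HasFDerivWithinAt r (fderiv ℝ r p) M p :=
    ((hr.smooth.differentiable (by simp)) p).hasFDerivAt.hasFDerivWithinAt
  have h2 : HasFDerivWithinAt r (ContinuousLinearMap.id ℝ _) M p :=
    (hasFDerivWithinAt_id p M).congr hr.fix (hr.fix p hp)
  exact fderiv_unique h1 h2 hv

theorem IsRetraction.bracket (hr : IsRetraction M r) (hX : IsVectorField M X)
    (hY : IsVectorField M Y) : IsVectorField M (bracket M X Y) := by
  have hXr : ∀ x ∈ M, X x = (X ∘ r) x := fun x hx => by simp [hr.fix x hx]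
  have hYr : ∀ x ∈ M, Y x = (Y ∘ r) x := fun x hx => by simp [hr.fix x hx]
  have hF := hr.contDiff hX
  have hG := hr.contDiff hY
  have key : ∀ x ∈ M, CRModel.bracket M X Y x = VectorField.lieBracket ℝ (X ∘ r) (Y ∘ r) x :=
    fun x hx => bracket_eq_lieBracket hX hY hF hG hXr hYr hx
  refine ⟨(contDiff_lieBracket hF hG).contDiffOn.congr key, fun p hp => ?_,
    fun p hp => bracket_zero_off hp⟩
  rw [key p hp]
  -- `X ∘ r` and `Y ∘ r` are `r`-related to themselves along `M`
  have d1 : ∀ {U V : (Fin n → ℂ) → (Fin n → ℂ)}, IsVectorField M U → IsVectorField M V →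
      fderiv ℝ (U ∘ r) p (V p) =
        fderiv ℝ (fderiv ℝ r) p (V p) (U p) + fderiv ℝ r p (fderiv ℝ (U ∘ r) p (V p)) := by
    intro U V hU hV
    have hUr := hr.contDiff hU
    have e1 : HasFDerivAt (fun x => fderiv ℝ r x) (fderiv ℝ (fderiv ℝ r) p) p :=
      ((hr.smooth.fderiv_right (m := ∞) (by simp)).differentiable (by simp) p).hasFDerivAt
    have e2 : HasFDerivAt (U ∘ r) (fderiv ℝ (U ∘ r) p) p :=
      (hUr.differentiable (by simp) p).hasFDerivAt
    have e3 := (e1.clm_apply e2).hasFDerivWithinAt (s := M)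
    have e4 := e3.congr (f₁ := U ∘ r) (fun x hx => by
      have := hr.fderiv_eq hx (hU.tangent x hx)
      simp [hr.fix x hx, this]) (by
      have := hr.fderiv_eq hp (hU.tangent p hp)
      simp [hr.fix p hp, this])
    have e5 := fderiv_unique e2.hasFDerivWithinAt e4 (hV.tangent p hp)
    refine e5.trans ?_
    simp only [Function.comp_apply, add_apply,
      ContinuousLinearMap.comp_apply, ContinuousLinearMap.flip_apply, hr.fix p hp]
    abel
  have hsymm : IsSymmSndFDerivAt ℝ r p :=
    hr.smooth.contDiffAt.isSymmSndFDerivAt (by simpa using two_le_infty)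
  have : VectorField.lieBracket ℝ (X ∘ r) (Y ∘ r) p =
      fderiv ℝ r p (VectorField.lieBracket ℝ (X ∘ r) (Y ∘ r) p) := by
    have a := d1 hX hY
    have b := d1 hY hX
    simp only [VectorField.lieBracket, Function.comp_apply, hr.fix p hp, map_sub]
    rw [hsymm.eq] at a
    nth_rewrite 1 [a]
    nth_rewrite 1 [b]
    abel
  rw [this]
  exact hr.fderiv_mem hp _

theorem IsRetraction.jacobi (hr : IsRetraction M r) (hX : IsVectorField M X)
    (hY : IsVectorField M Y) (hZ : IsVectorField M Z) :
    CRModel.bracket M X (CRModel.bracket M Y Z) =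
      CRModel.bracket M (CRModel.bracket M X Y) Z +
        CRModel.bracket M Y (CRModel.bracket M X Z) := by
  have hc : ∀ {U : (Fin n → ℂ) → (Fin n → ℂ)}, ∀ x ∈ M, U x = (U ∘ r) x :=
    fun x hx => by simp [hr.fix x hx]
  have key : ∀ {U V : (Fin n → ℂ) → (Fin n → ℂ)}, IsVectorField M U → IsVectorField M V →
      ∀ x ∈ M, CRModel.bracket M U V x = VectorField.lieBracket ℝ (U ∘ r) (V ∘ r) x :=
    fun hU hV x hx =>
      bracket_eq_lieBracket hU hV (hr.contDiff hU) (hr.contDiff hV) hc hc hx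
  have cX := hr.contDiff hX
  have cY := hr.contDiff hY
  have cZ := hr.contDiff hZ
  funext p
  by_cases hp : p ∈ M
  · rw [Pi.add_apply,
      bracket_eq_lieBracket hX (hr.bracket hY hZ) cX (contDiff_lieBracket cY cZ) hc (key hY hZ) hp,
      bracket_eq_lieBracket (hr.bracket hX hY) hZ (contDiff_lieBracket cX cY) cZ (key hX hY) hc hp,
      bracket_eq_lieBracket hY (hr.bracket hX hZ) cY (contDiff_lieBracket cX cZ) hc (key hX hZ) hp]
    exact VectorField.leibniz_identity_lieBracket (n := ∞) (by simpa using two_le_infty) cX.contDiffAt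
      cY.contDiffAt cZ.contDiffAt
  · simp [bracket_zero_off hp]

theorem IsInfCRAut.bracket_field (hr : IsRetraction M r) (hX : IsInfCRAut M X)
    (hY : IsComplexTangentField M Y) : IsComplexTangentField M (CRModel.bracket M X Y) where
  toIsVectorField := hr.bracket hX.toIsVectorField hY.toIsVectorField
  complex_tangent := hX.bracket_mem Y hY

theorem IsInfCRAut.bracket_smul_I (hX : IsInfCRAut M X) (hY : IsComplexTangentField M Y) :
    CRModel.bracket M X (Complex.I • Y) = Complex.I • CRModel.bracket M X Y := by
  funext p
  by_cases hp : p ∈ M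
  · exact hX.bracket_I Y hY p hp
  · simp [bracket_zero_off hp]

theorem IsInfCRAut.bracket (hr : IsRetraction M r) (hX : IsInfCRAut M X)
    (hY : IsInfCRAut M Y) : IsInfCRAut M (CRModel.bracket M X Y) := by
  have jac : ∀ {Z}, IsComplexTangentField M Z →
      CRModel.bracket M (CRModel.bracket M X Y) Z =
        CRModel.bracket M X (CRModel.bracket M Y Z) -
          CRModel.bracket M Y (CRModel.bracket M X Z) := fun hZ => by
    rw [hr.jacobi hX.toIsVectorField hY.toIsVectorField hZ.toIsVectorField]
    abel
  refine ⟨hr.bracket hX.toIsVectorField hY.toIsVectorField, fun Z hZ p hp => ?_,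
    fun Z hZ p hp => ?_⟩
  · rw [jac hZ]
    exact sub_mem (hX.bracket_mem _ (hY.bracket_field hr hZ) p hp)
      (hY.bracket_mem _ (hX.bracket_field hr hZ) p hp)
  · rw [jac hZ, jac hZ.smul_I, hX.bracket_smul_I hZ, hY.bracket_smul_I hZ,
      hX.bracket_smul_I (hY.bracket_field hr hZ), hY.bracket_smul_I (hX.bracket_field hr hZ)]
    simp [smul_sub]

end Retract

/-! ### The model -/

/-- The model `N ⊂ ℂ⁴` of class `III₂`, in the coordinates `(z, w₁, w₂, w₃) = (p 0, …, p 3)`. -/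
def modelN : Set (Fin 4 → ℂ) :=
  {p | p 1 = conj (p 1) + 2 * Complex.I * (p 0 * conj (p 0)) ∧
    p 2 = conj (p 2) + 2 * Complex.I * (p 0 * conj (p 0) * (p 0 + conj (p 0))) ∧
    p 3 = conj (p 3) + 2 * Complex.I * (p 0 * conj (p 0) *
      (p 0 ^ 2 + 3 / 2 * (p 0 * conj (p 0)) + conj (p 0) ^ 2))}

/-- The retraction of `ℂ⁴` onto `N` along the directions of `Im w₁, Im w₂, Im w₃`. -/
noncomputable def retrN (p : Fin 4 → ℂ) : Fin 4 → ℂ :=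
  ![p 0,
    (p 1 + conj (p 1)) / 2 + Complex.I * (p 0 * conj (p 0)),
    (p 2 + conj (p 2)) / 2 + Complex.I * (p 0 * conj (p 0) * (p 0 + conj (p 0))),
    (p 3 + conj (p 3)) / 2 + Complex.I * (p 0 * conj (p 0) *
      (p 0 ^ 2 + 3 / 2 * (p 0 * conj (p 0)) + conj (p 0) ^ 2))]

theorem isRetraction_retrN : IsRetraction modelN retrN where
  smooth := by
    have hx : ∀ i : Fin 4, ContDiff ℝ ∞ fun p : Fin 4 → ℂ => p i := fun i =>
      contDiff_apply ℝ ℂ i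
    have hc : ∀ i : Fin 4, ContDiff ℝ ∞ fun p : Fin 4 → ℂ => conj (p i) := fun i =>
      Complex.conjCLE.contDiff.comp (hx i)
    have h0 := hx 0
    have h1 := hx 1
    have h2 := hx 2
    have h3 := hx 3
    have c0 := hc 0
    have c1 := hc 1
    have c2 := hc 2
    have c3 := hc 3
    rw [contDiff_pi]
    intro i
    fin_cases i
    · exact h0
    · exact ((h1.add c1).div_const 2).add (contDiff_const.mul (h0.mul c0))
    · exact ((h2.add c2).div_const 2).add (contDiff_const.mul ((h0.mul c0).mul (h0.add c0)))
    · exact ((h3.add c3).div_const 2).add (contDiff_const.mul ((h0.mul c0).mul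
        (((h0.pow 2).add (contDiff_const.mul (h0.mul c0))).add (c0.pow 2))))
  maps p := by
    refine ⟨?_, ?_, ?_⟩ <;> simp [retrN, Complex.conj_ofNat] <;> ring
  fix p hp := by
    obtain ⟨h1, h2, h3⟩ := hp
    funext i
    fin_cases i
    · simp [retrN]
    · simp only [retrN]
      simp
      linear_combination (-1 / 2 : ℂ) * h1
    · simp [retrN]
      linear_combination (-1 / 2 : ℂ) * h2
    · simp [retrN]
      linear_combination (-1 / 2 : ℂ) * h3

/-- The Lie bracket of vector fields on `aut_CR(N)`. -/
noncomputable instance : Bracket (autCR modelN) (autCR modelN) where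
  bracket X Y := ⟨bracket modelN X.1 Y.1, IsInfCRAut.bracket isRetraction_retrN X.2 Y.2⟩

noncomputable instance : LieRing (autCR modelN) where
  add_lie X Y Z := Subtype.ext
    (bracket_add_left X.2.toIsVectorField Y.2.toIsVectorField Z.2.toIsVectorField)
  lie_add X Y Z := Subtype.ext
    (bracket_add_right X.2.toIsVectorField Y.2.toIsVectorField Z.2.toIsVectorField)
  lie_self X := Subtype.ext (by
    funext p
    change bracket modelN X.1 X.1 p = 0
    by_cases hp : p ∈ modelN
    · simp [bracket_apply hp]
    · exact bracket_zero_off hp)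
  leibniz_lie X Y Z := Subtype.ext (isRetraction_retrN.jacobi
    X.2.toIsVectorField Y.2.toIsVectorField Z.2.toIsVectorField)

noncomputable instance : LieAlgebra ℝ (autCR modelN) where
  lie_smul c X Y := Subtype.ext
    (bracket_smul_right c X.2.toIsVectorField Y.2.toIsVectorField)

/-! ### Maurer-Cartan forms of a Lie algebra

The complex-valued Maurer-Cartan forms (left-invariant `1`-forms on a Lie group with Lie algebra
`𝔤`) are the real linear maps `𝔤 → ℂ`; left-invariant `2`-forms are given by their values on
pairs of elements of `𝔤`. -/

/-- The exterior derivative of a left-invariant `1`-form: `dφ(X, Y) = -φ([X, Y])`. -/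
noncomputable def mcDeriv {𝔤 : Type*} [LieRing 𝔤] [LieAlgebra ℝ 𝔤] (φ : 𝔤 →ₗ[ℝ] ℂ) : 𝔤 → 𝔤 → ℂ :=
  fun X Y => -φ ⁅X, Y⁆

/-- The wedge product of two left-invariant `1`-forms. -/
noncomputable def wedge {𝔤 : Type*} [LieRing 𝔤] [LieAlgebra ℝ 𝔤] (φ ψ : 𝔤 →ₗ[ℝ] ℂ) : 𝔤 → 𝔤 → ℂ :=
  fun X Y => φ X * ψ Y - φ Y * ψ X

/-- A real-valued form. -/
def IsRealForm {𝔤 : Type*} [LieRing 𝔤] [LieAlgebra ℝ 𝔤] (φ : 𝔤 →ₗ[ℝ] ℂ) : Prop :=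
  ∀ X, conj (φ X) = φ X

end CRModel

namespace CRModel

/-! Straightening. The mixed terms of `(z + z̄)^k`, for `k = 2, 3, 4`, are multiples of the three
defining polynomials. Adding a multiple of `i z^k` to each `w` therefore turns `N` into the tube
over the curve `(x, 2x², 8x³/3, 4x⁴)`, where `x = Re z`. This gives a global chart by `ℝ⁵`. There
the complex tangent bundle is spanned by `P = ∂_x` and `Q = JP`, and iterated brackets produce a
frame: `[P,Q] = -2T`, `[P,T] = 2S`, `[P,S] = 2R`, with `[P,R] = [Q,T] = 0`.

Upper bound. An infinitesimal CR automorphism has components `f = X₀` along `P, Q` (a complex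
function) and real components `a, b, c` along `T, S, R`. The CR condition becomes `Pa = 2 Im f`, `Qa
= -2 Re f`, `Pb = -2a`, `Pc = -2b`, `Qb = Qc = 0` and `Qf = iPf`. Applying the commutators to `a, b,
c` closes this system (`prolongation`): the function `Ta` is annihilated by `P` and `Q`. Since `P`
and `Q` generate the tangent bundle by brackets, such a function is constant on a connected open
set. Integrating back introduces one constant for each of `Im f, Re f, a, b, c`, so there are six
parameters (`exists_solution_parameters`). The argument is local, which also yields the extension
statement.

Lower bound. The six parameters are realized by the polynomial holomorphic fields `holField`: a
dilation with weights `1, 2, 3, 4`, and five fields that move the origin of `N`. They are tangent to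
`N` (`holField_chart`) and preserve the CR structure (`bracket_restrictHol`). Their brackets are
computed in `ℂ⁴` (`lieBracket_holField`), and the structure equations are the dual statement after
rescaling the coordinate forms. -/

/-! ### A global chart of the model -/

/-- The complex coordinate `z = x + i y`. -/
noncomputable def zc (e : Fin 5 → ℝ) : ℂ := (e 0 : ℂ) + Complex.I * (e 1 : ℂ)

/-- A global parametrization of `N`, adapted to its description as a tube. -/
noncomputable def chart (e : Fin 5 → ℝ) : Fin 4 → ℂ :=
  ![zc e,
    (e 2 : ℂ) + 2 * Complex.I * (e 0 : ℂ) ^ 2 - Complex.I * zc e ^ 2,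
    (e 3 : ℂ) + 8 / 3 * Complex.I * (e 0 : ℂ) ^ 3 - 2 / 3 * Complex.I * zc e ^ 3,
    (e 4 : ℂ) + 4 * Complex.I * (e 0 : ℂ) ^ 4 - 1 / 2 * Complex.I * zc e ^ 4]

/-- The inverse of `chart`. -/
noncomputable def chartInv (p : Fin 4 → ℂ) : Fin 5 → ℝ :=
  ![(p 0).re, (p 0).im,
    (p 1 + Complex.I * p 0 ^ 2).re,
    (p 2 + 2 / 3 * Complex.I * p 0 ^ 3).re,
    (p 3 + 1 / 2 * Complex.I * p 0 ^ 4).re]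

/-- The complex tangent direction of `N` along the first coordinate of the chart. -/
noncomputable def crVec (e : Fin 5 → ℝ) : Fin 4 → ℂ :=
  ![1,
    4 * Complex.I * (e 0 : ℂ) - 2 * Complex.I * zc e,
    8 * Complex.I * (e 0 : ℂ) ^ 2 - 2 * Complex.I * zc e ^ 2,
    16 * Complex.I * (e 0 : ℂ) ^ 3 - 2 * Complex.I * zc e ^ 3]

theorem hasFDerivAt_coord (i : Fin 5) (e : Fin 5 → ℝ) :
    HasFDerivAt (fun e : Fin 5 → ℝ => ((e i : ℝ) : ℂ))
      (Complex.ofRealCLM.comp (ContinuousLinearMap.proj i)) e :=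
  (Complex.ofRealCLM.comp (ContinuousLinearMap.proj i : (Fin 5 → ℝ) →L[ℝ] ℝ)).hasFDerivAt

theorem hasFDerivAt_zc (e : Fin 5 → ℝ) :
    HasFDerivAt zc (Complex.ofRealCLM.comp (ContinuousLinearMap.proj 0) +
      Complex.I • Complex.ofRealCLM.comp (ContinuousLinearMap.proj 1)) e :=
  (hasFDerivAt_coord 0 e).add ((hasFDerivAt_coord 1 e).const_mul Complex.I)

/-- The derivative of `chart`. -/
noncomputable def dchart (e : Fin 5 → ℝ) : (Fin 5 → ℝ) →L[ℝ] (Fin 4 → ℂ) := fderiv ℝ chart e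

theorem contDiff_coord (i : Fin 5) :
    ContDiff ℝ ∞ fun e : Fin 5 → ℝ => ((e i : ℝ) : ℂ) :=
  (Complex.ofRealCLM.comp (ContinuousLinearMap.proj i : (Fin 5 → ℝ) →L[ℝ] ℝ)).contDiff

theorem contDiff_zc : ContDiff ℝ ∞ zc :=
  (contDiff_coord 0).add (contDiff_const.mul (contDiff_coord 1))

theorem contDiff_chart : ContDiff ℝ ∞ chart := by
  have h := contDiff_coord
  have hz := contDiff_zc
  rw [contDiff_pi]
  intro i
  fin_cases i
  · exact hz
  · exact ((h 2).add (contDiff_const.mul ((h 0).pow 2))).sub (contDiff_const.mul (hz.pow 2))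
  · exact ((h 3).add (contDiff_const.mul ((h 0).pow 3))).sub (contDiff_const.mul (hz.pow 3))
  · exact ((h 4).add (contDiff_const.mul ((h 0).pow 4))).sub (contDiff_const.mul (hz.pow 4))

theorem contDiff_crVec : ContDiff ℝ ∞ crVec := by
  have h := contDiff_coord
  have hz := contDiff_zc
  rw [contDiff_pi]
  intro i
  fin_cases i
  · exact contDiff_const
  · exact (contDiff_const.mul (h 0)).sub (contDiff_const.mul hz)
  · exact (contDiff_const.mul ((h 0).pow 2)).sub (contDiff_const.mul (hz.pow 2))
  · exact (contDiff_const.mul ((h 0).pow 3)).sub (contDiff_const.mul (hz.pow 3))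

theorem contDiff_chartInv : ContDiff ℝ ∞ chartInv := by
  have h : ∀ i : Fin 4, ContDiff ℝ ∞ fun p : Fin 4 → ℂ => p i := fun i => contDiff_apply ℝ ℂ i
  have hre := Complex.reCLM.contDiff (n := ∞)
  rw [contDiff_pi]
  intro i
  fin_cases i
  · exact hre.comp (h 0)
  · exact Complex.imCLM.contDiff.comp (h 0)
  · exact hre.comp ((h 1).add (contDiff_const.mul ((h 0).pow 2)))
  · exact hre.comp ((h 2).add (contDiff_const.mul ((h 0).pow 3)))
  · exact hre.comp ((h 3).add (contDiff_const.mul ((h 0).pow 4)))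

theorem hasFDerivAt_chart (e : Fin 5 → ℝ) : HasFDerivAt chart (dchart e) e :=
  (contDiff_chart.differentiable (by simp) e).hasFDerivAt

/-- Allows a component of a derivative to be read off from one assembled by the product rules. -/
theorem fderiv_apply_pi {E : Type*} [NormedAddCommGroup E] [NormedSpace ℝ E] {m : ℕ}
    {f : E → Fin m → ℂ} {e : E} (hf : DifferentiableAt ℝ f e) {i : Fin m} {h : E → ℂ}
    {g : E →L[ℝ] ℂ} (hg : HasFDerivAt h g e) (hfh : ∀ x, f x i = h x) (w : E) :
    fderiv ℝ f e w i = g w := by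
  obtain rfl : (fun x => f x i) = h := funext hfh
  exact congrArg (fun L : E →L[ℝ] ℂ => L w)
    (((hasFDerivAt_pi'.1 hf.hasFDerivAt) i).unique hg)

/-- The splitting displays the CR structure: a complex multiple of `crVec` plus a vertical vector
with real entries. The terms in `w 1` appear because `∂_y` differs from `J ∂_x` by a real vertical
vector. -/
theorem dchart_apply (e w : Fin 5 → ℝ) : dchart e w =
    ((w 0 : ℂ) + Complex.I * (w 1 : ℂ)) • crVec e +
      ![0, (w 2 : ℂ) + 4 * (e 0 : ℂ) * (w 1 : ℂ), (w 3 : ℂ) + 8 * (e 0 : ℂ) ^ 2 * (w 1 : ℂ),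
        (w 4 : ℂ) + 16 * (e 0 : ℂ) ^ 3 * (w 1 : ℂ)] := by
  have hd := contDiff_chart.differentiable (by simp) e
  have h := fun i => hasFDerivAt_coord i e
  have hz := hasFDerivAt_zc e
  funext i
  fin_cases i
  · refine (fderiv_apply_pi hd hz (fun _ => rfl) w).trans ?_
    simp [crVec]
  · refine (fderiv_apply_pi hd (((h 2).add (((h 0).pow 2).const_mul _)).sub
      ((hz.pow 2).const_mul _)) (fun _ => rfl) w).trans ?_
    simp [crVec]
    linear_combination (-4 * (e 0 : ℂ) * w 1) * Complex.I_mul_I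
  · refine (fderiv_apply_pi hd (((h 3).add (((h 0).pow 3).const_mul _)).sub
      ((hz.pow 3).const_mul _)) (fun _ => rfl) w).trans ?_
    simp [crVec]
    linear_combination (-8 * (e 0 : ℂ) ^ 2 * w 1) * Complex.I_mul_I
  · refine (fderiv_apply_pi hd (((h 4).add (((h 0).pow 4).const_mul _)).sub
      ((hz.pow 4).const_mul _)) (fun _ => rfl) w).trans ?_
    simp [crVec]
    linear_combination (-16 * (e 0 : ℂ) ^ 3 * w 1) * Complex.I_mul_I

theorem fderiv_crVec_apply (e w : Fin 5 → ℝ) : fderiv ℝ crVec e w =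
    ![0, 4 * Complex.I * (w 0 : ℂ) - 2 * Complex.I * ((w 0 : ℂ) + Complex.I * (w 1 : ℂ)),
      16 * Complex.I * (e 0 : ℂ) * (w 0 : ℂ)
        - 4 * Complex.I * zc e * ((w 0 : ℂ) + Complex.I * (w 1 : ℂ)),
      48 * Complex.I * (e 0 : ℂ) ^ 2 * (w 0 : ℂ)
        - 6 * Complex.I * zc e ^ 2 * ((w 0 : ℂ) + Complex.I * (w 1 : ℂ))] := by
  have hd := contDiff_crVec.differentiable (by simp) e
  have h := fun i => hasFDerivAt_coord i e
  have hz := hasFDerivAt_zc e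
  funext i
  fin_cases i
  · refine (fderiv_apply_pi hd (hasFDerivAt_const _ _) (fun _ => rfl) w).trans ?_
    simp
  · refine (fderiv_apply_pi hd (((h 0).const_mul _).sub (hz.const_mul _)) (fun _ => rfl) w).trans ?_
    simp
    ring
  · refine (fderiv_apply_pi hd ((((h 0).pow 2).const_mul _).sub
      ((hz.pow 2).const_mul _)) (fun _ => rfl) w).trans ?_
    simp
    ring
  · refine (fderiv_apply_pi hd ((((h 0).pow 3).const_mul _).sub
      ((hz.pow 3).const_mul _)) (fun _ => rfl) w).trans ?_
    simp
    ring

theorem conj_zc (e : Fin 5 → ℝ) : conj (zc e) = 2 * (e 0 : ℂ) - zc e := by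
  simp [zc]
  ring

/-- With `2x = z + z̄`, the three equations are the binomial expansions of `(2x)²`, `(2x)³` and
`(2x)⁴`. -/
theorem chart_mem (e : Fin 5 → ℝ) : chart e ∈ modelN := by
  have hc := conj_zc e
  refine ⟨?_, ?_, ?_⟩ <;> simp [chart, Complex.conj_ofNat, hc] <;> ring

theorem chartInv_chart (e : Fin 5 → ℝ) : chartInv (chart e) = e := by
  funext i
  fin_cases i
  · simp [chartInv, chart, zc]
  · simp [chartInv, chart, zc]
  · simp [chartInv, chart, pow_succ]
  · simp [chartInv, chart, pow_succ]
  · simp [chartInv, chart, pow_succ]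

theorem chart_chartInv {p : Fin 4 → ℂ} (hp : p ∈ modelN) : chart (chartInv p) = p := by
  obtain ⟨h1, h2, h3⟩ := hp
  have hz : zc (chartInv p) = p 0 := by
    simp [zc, chartInv, mul_comm Complex.I]
  have hx : ((chartInv p 0 : ℝ) : ℂ) = (p 0 + conj (p 0)) / 2 := by
    simp [chartInv, Complex.re_eq_add_conj]
  funext i
  fin_cases i
  · simp [chart, hz]
  · have h : ((chartInv p 2 : ℝ) : ℂ) =
        (p 1 + Complex.I * p 0 ^ 2 + conj (p 1 + Complex.I * p 0 ^ 2)) / 2 := by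
      rw [← Complex.re_eq_add_conj]; simp [chartInv]
    simp [chart, hz, hx, h]
    linear_combination (-1 / 2 : ℂ) * h1
  · have h : ((chartInv p 3 : ℝ) : ℂ) =
        (p 2 + 2 / 3 * Complex.I * p 0 ^ 3 + conj (p 2 + 2 / 3 * Complex.I * p 0 ^ 3)) / 2 := by
      rw [← Complex.re_eq_add_conj]; simp [chartInv]
    simp [chart, hz, hx, h, Complex.conj_ofNat]
    linear_combination (-1 / 2 : ℂ) * h2
  · have h : ((chartInv p 4 : ℝ) : ℂ) =
        (p 3 + 1 / 2 * Complex.I * p 0 ^ 4 + conj (p 3 + 1 / 2 * Complex.I * p 0 ^ 4)) / 2 := by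
      rw [← Complex.re_eq_add_conj]; simp [chartInv]
    simp [chart, hz, hx, h, Complex.conj_ofNat]
    linear_combination (-1 / 2 : ℂ) * h3

/-! ### Tangent spaces of open subsets of the model -/

section Tangent

variable {W : Set (Fin 4 → ℂ)} {e : Fin 5 → ℝ}

theorem dchart_mem_tangentSp (hW : IsOpen W) (he : chart e ∈ W) (w : Fin 5 → ℝ) :
    dchart e w ∈ tangentSp (modelN ∩ W) (chart e) := by
  have ho : IsOpen (chart ⁻¹' W) := hW.preimage contDiff_chart.continuous
  have h2 : dchart e w ∈ tangentConeAt ℝ (chart '' (chart ⁻¹' W)) (chart e) :=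
    (hasFDerivAt_chart e).hasFDerivWithinAt.mapsTo_tangent_cone
      (by rw [tangentConeAt_of_mem_nhds (ho.mem_nhds he)]; trivial)
  have hsub : chart '' (chart ⁻¹' W) ⊆ modelN ∩ W := by
    rintro _ ⟨x, hx, rfl⟩
    exact ⟨chart_mem x, hx⟩
  exact Submodule.subset_span (tangentConeAt_mono hsub h2)

/-- `chart ∘ chartInv` is a smooth retraction onto `N`, so its derivative fixes tangent vectors; by
the chain rule that derivative factors through `dchart e`. -/
theorem exists_dchart_of_mem {v : Fin 4 → ℂ} (hv : v ∈ tangentSp (modelN ∩ W) (chart e)) :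
    ∃ w, v = dchart e w := by
  have hr : IsRetraction modelN (chart ∘ chartInv) :=
    ⟨contDiff_chart.comp contDiff_chartInv, fun x => chart_mem _, fun x hx => chart_chartInv hx⟩
  have hv' : v ∈ tangentSp modelN (chart e) :=
    Submodule.span_mono (tangentConeAt_mono Set.inter_subset_left) hv
  have h := hr.fderiv_eq (chart_mem e) hv'
  have h2 : HasFDerivAt (chart ∘ chartInv)
      ((dchart e).comp (fderiv ℝ chartInv (chart e))) (chart e) := by
    refine HasFDerivAt.comp _ ?_ (contDiff_chartInv.differentiable (by simp) _).hasFDerivAt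
    rw [chartInv_chart]
    exact hasFDerivAt_chart e
  rw [h2.fderiv] at h
  exact ⟨_, h.symm⟩

theorem smul_crVec_mem (hW : IsOpen W) (he : chart e ∈ W) (f : ℂ) :
    f • crVec e ∈ complexTangentSp (modelN ∩ W) (chart e) := by
  have key : ∀ f : ℂ, f • crVec e ∈ tangentSp (modelN ∩ W) (chart e) := by
    intro f
    have h := dchart_mem_tangentSp hW he
      -- The coordinates of `f.re • P + f.im • Q`; the last three entries cancel the vertical part
      -- in `dchart_apply`.
      ![f.re, f.im, -4 * e 0 * f.im, -8 * e 0 ^ 2 * f.im, -16 * e 0 ^ 3 * f.im]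
    convert h using 1
    rw [dchart_apply]
    have hf : (f.re : ℂ) + Complex.I * f.im = f := by rw [mul_comm]; exact Complex.re_add_im f
    funext i
    fin_cases i <;> simp [hf]
  refine ⟨key f, ?_⟩
  change Complex.I • f • crVec e ∈ tangentSp (modelN ∩ W) (chart e)
  rw [smul_smul]
  exact key _

/-- Both `v` and `i v` have real vertical part, and the vertical part of `i v` is `i` times that of
`v`; hence it vanishes. -/
theorem eq_smul_crVec {v : Fin 4 → ℂ}
    (hv : v ∈ complexTangentSp (modelN ∩ W) (chart e)) : v = v 0 • crVec e := by
  obtain ⟨w, hw⟩ := exists_dchart_of_mem hv.1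
  obtain ⟨w', hw'⟩ := exists_dchart_of_mem (v := Complex.I • v) hv.2
  rw [dchart_apply] at hw hw'
  rw [hw] at hw' ⊢
  have key : ∀ {l f f' : ℂ} {k k' : ℝ}, Complex.I * f = f' →
      Complex.I * (f * l + k) = f' * l + k' → (k : ℂ) = 0 := by
    intro l f f' k k' h1 h2
    rw [← h1] at h2
    have h3 : Complex.I * k = k' := by linear_combination h2
    have h4 := congrArg Complex.im h3
    simpa using h4
  have h0 := congrFun hw' 0
  have h1 := congrFun hw' 1
  have h2 := congrFun hw' 2
  have h3 := congrFun hw' 3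
  simp only [Pi.smul_apply, Pi.add_apply, smul_eq_mul, crVec, Matrix.cons_val_zero,
    Matrix.cons_val_one, Matrix.cons_val, mul_one, add_zero] at h0 h1 h2 h3
  have r1 := key (k := w 2 + 4 * e 0 * w 1) (k' := w' 2 + 4 * e 0 * w' 1) h0 (by
    push_cast; exact h1)
  have r2 := key (k := w 3 + 8 * e 0 ^ 2 * w 1) (k' := w' 3 + 8 * e 0 ^ 2 * w' 1) h0 (by
    push_cast; exact h2)
  have r3 := key (k := w 4 + 16 * e 0 ^ 3 * w 1) (k' := w' 4 + 16 * e 0 ^ 3 * w' 1) h0 (by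
    push_cast; exact h3)
  push_cast at r1 r2 r3
  funext i
  fin_cases i <;> simp [r1, r2, r3, crVec]

/-- The derivative of a vector field along the model, read in the chart. -/
theorem IsVectorField.hasFDerivAt_chart (hW : IsOpen W) (he : chart e ∈ W)
    {X : (Fin 4 → ℂ) → (Fin 4 → ℂ)} (hX : IsVectorField (modelN ∩ W) X) :
    HasFDerivAt (X ∘ chart)
      ((fderivWithin ℝ X (modelN ∩ W) (chart e)).comp (dchart e)) e := by
  have ho : IsOpen (chart ⁻¹' W) := hW.preimage contDiff_chart.continuous
  have hm : Set.MapsTo chart (chart ⁻¹' W) (modelN ∩ W) := fun x hx => ⟨chart_mem x, hx⟩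
  have h := (hX.diff (p := chart e) ⟨chart_mem e, he⟩).comp e
    (CRModel.hasFDerivAt_chart e).hasFDerivWithinAt hm
  exact h.hasFDerivAt (ho.mem_nhds he)

theorem IsVectorField.contDiffOn_chart {X : (Fin 4 → ℂ) → (Fin 4 → ℂ)}
    (hX : IsVectorField (modelN ∩ W) X) : ContDiffOn ℝ ∞ (X ∘ chart) (chart ⁻¹' W) :=
  hX.smooth.comp contDiff_chart.contDiffOn fun x hx => ⟨chart_mem x, hx⟩

end Tangent

/-! ### Smooth functions on an open set and directional derivatives -/

section Derivations

variable {E : Type*} [NormedAddCommGroup E] [NormedSpace ℝ E] {Ω : Set E}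

/-- The smooth real functions on `Ω`, extended by zero. -/
def smoothFun (Ω : Set E) : Submodule ℝ (E → ℝ) where
  carrier := {f | ContDiffOn ℝ ∞ f Ω ∧ ∀ p, p ∉ Ω → f p = 0}
  zero_mem' := ⟨contDiffOn_const, fun _ _ => rfl⟩
  add_mem' := fun hf hg => ⟨hf.1.add hg.1, fun p hp => by simp [hf.2 p hp, hg.2 p hp]⟩
  smul_mem' := fun c _ hf => ⟨contDiffOn_const.smul hf.1, fun p hp => by simp [hf.2 p hp]⟩

theorem hasFDerivAt_smoothFun (hΩ : IsOpen Ω) (f : smoothFun Ω) {p : E} (hp : p ∈ Ω) :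
    HasFDerivAt f.1 (fderiv ℝ f.1 p) p :=
  ((f.2.1.contDiffAt (hΩ.mem_nhds hp)).differentiableAt (by simp)).hasFDerivAt

theorem contDiffOn_fderiv_smoothFun (hΩ : IsOpen Ω) (f : smoothFun Ω) :
    ContDiffOn ℝ ∞ (fderiv ℝ f.1) Ω :=
  f.2.1.fderiv_of_isOpen hΩ (by simp)

/-- The smooth function on `Ω` defined by a function on the ambient space. -/
noncomputable def restrictFun (f : E → ℝ) (hf : ContDiffOn ℝ ∞ f Ω) : smoothFun Ω :=
  ⟨Ω.indicator f, hf.congr fun _ hp => Set.indicator_of_mem hp f,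
    fun _ hp => Set.indicator_of_notMem hp f⟩

theorem restrictFun_apply {f : E → ℝ} (hf : ContDiffOn ℝ ∞ f Ω) {p : E} (hp : p ∈ Ω) :
    (restrictFun f hf).1 p = f p :=
  Set.indicator_of_mem hp f

theorem fderiv_restrictFun (hΩ : IsOpen Ω) {f : E → ℝ} (hf : ContDiffOn ℝ ∞ f Ω) {p : E}
    (hp : p ∈ Ω) : fderiv ℝ (restrictFun f hf).1 p = fderiv ℝ f p :=
  Filter.EventuallyEq.fderiv_eq
    (Filter.eventually_of_mem (hΩ.mem_nhds hp) fun _ hq => restrictFun_apply hf hq)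

/-- Extension by zero makes equality on `Ω` an equality of elements, so that differential operators
become endomorphisms of a vector space, as `prolongation` requires. -/
theorem smoothFun_ext {f g : smoothFun Ω} (h : ∀ p ∈ Ω, f.1 p = g.1 p) : f = g :=
  Subtype.ext <| funext fun p => by
    by_cases hp : p ∈ Ω
    · exact h p hp
    · rw [f.2.2 p hp, g.2.2 p hp]

/-- The derivative of smooth functions on `Ω` along a vector field. -/
noncomputable def alongField (hΩ : IsOpen Ω) {V : E → E} (hV : ContDiff ℝ ∞ V) :
    smoothFun Ω →ₗ[ℝ] smoothFun Ω where
  toFun f := restrictFun (fun p => fderiv ℝ f.1 p (V p))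
    ((contDiffOn_fderiv_smoothFun hΩ f).clm_apply hV.contDiffOn)
  map_add' f g := smoothFun_ext fun p hp => by
    have h := ((hasFDerivAt_smoothFun hΩ f hp).add (hasFDerivAt_smoothFun hΩ g hp)).fderiv
    rw [restrictFun_apply _ hp]
    change fderiv ℝ (f.1 + g.1) p (V p) = (restrictFun _ _).1 p + (restrictFun _ _).1 p
    rw [h, restrictFun_apply _ hp, restrictFun_apply _ hp]
    rfl
  map_smul' c f := smoothFun_ext fun p hp => by
    have h := ((hasFDerivAt_smoothFun hΩ f hp).const_smul c).fderiv
    rw [restrictFun_apply _ hp]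
    change fderiv ℝ (c • f.1) p (V p) = c • (restrictFun _ _).1 p
    rw [h, restrictFun_apply _ hp]
    rfl

theorem alongField_apply (hΩ : IsOpen Ω) {V : E → E} (hV : ContDiff ℝ ∞ V) (f : smoothFun Ω)
    {p : E} (hp : p ∈ Ω) : (alongField hΩ hV f).1 p = fderiv ℝ f.1 p (V p) :=
  restrictFun_apply ((contDiffOn_fderiv_smoothFun hΩ f).clm_apply hV.contDiffOn) hp

theorem alongField_alongField (hΩ : IsOpen Ω) {V U : E → E} (hV : ContDiff ℝ ∞ V)
    (hU : ContDiff ℝ ∞ U) (f : smoothFun Ω) {p : E} (hp : p ∈ Ω) :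
    (alongField hΩ hU (alongField hΩ hV f)).1 p =
      fderiv ℝ (fderiv ℝ f.1) p (U p) (V p) + fderiv ℝ f.1 p (fderiv ℝ V p (U p)) := by
  have h1 : HasFDerivAt (fderiv ℝ f.1) (fderiv ℝ (fderiv ℝ f.1) p) p :=
    (((contDiffOn_fderiv_smoothFun hΩ f).contDiffAt (hΩ.mem_nhds hp)).differentiableAt
      (by simp)).hasFDerivAt
  have h2 : HasFDerivAt V (fderiv ℝ V p) p := (hV.differentiable (by simp) p).hasFDerivAt
  rw [alongField_apply _ _ _ hp]
  change fderiv ℝ (restrictFun _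
    ((contDiffOn_fderiv_smoothFun hΩ f).clm_apply hV.contDiffOn)).1 p (U p) = _
  rw [fderiv_restrictFun hΩ _ hp, (h1.clm_apply h2).fderiv]
  simp [add_comm]

/-- The second-order terms cancel by symmetry of the second derivative. -/
theorem alongField_commutator (hΩ : IsOpen Ω) {V U Z : E → E} (hV : ContDiff ℝ ∞ V)
    (hU : ContDiff ℝ ∞ U) (hZ : ContDiff ℝ ∞ Z) (c : ℝ)
    (h : ∀ p ∈ Ω, fderiv ℝ V p (U p) - fderiv ℝ U p (V p) = c • Z p) (f : smoothFun Ω) :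
    alongField hΩ hU (alongField hΩ hV f) - alongField hΩ hV (alongField hΩ hU f) =
      c • alongField hΩ hZ f := by
  refine smoothFun_ext fun p hp => ?_
  have hs : IsSymmSndFDerivAt ℝ f.1 p :=
    (f.2.1.contDiffAt (hΩ.mem_nhds hp)).isSymmSndFDerivAt (by simpa using two_le_infty)
  change (alongField hΩ hU (alongField hΩ hV f)).1 p -
    (alongField hΩ hV (alongField hΩ hU f)).1 p = c * (alongField hΩ hZ f).1 p
  rw [alongField_alongField _ _ _ _ hp, alongField_alongField _ _ _ _ hp, hs.eq,
    alongField_apply _ _ _ hp, ← smul_eq_mul, ← map_smul, ← h p hp, map_sub]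
  abel

end Derivations

/-! ### The overdetermined system in abstract form -/

/-- The consequences of the equations for an infinitesimal CR automorphism with components
`(f, a, b, c)` along the frame `P, Q, T, S, R`, where `e₁ = 2 Im f` and `e₂ = -2 Re f`. -/
theorem prolongation {A : Type*} [AddCommGroup A] [Module ℝ A] (P Q T S R : A →ₗ[ℝ] A)
    (hPQ : ∀ u, P (Q u) - Q (P u) = (-2 : ℝ) • T u)
    (hPT : ∀ u, P (T u) - T (P u) = (2 : ℝ) • S u)
    (hPS : ∀ u, P (S u) - S (P u) = (2 : ℝ) • R u)
    (hPR : ∀ u, P (R u) - R (P u) = (0 : ℝ) • R u)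
    (hQT : ∀ u, Q (T u) - T (Q u) = (0 : ℝ) • R u)
    {a b c e₁ e₂ : A} (Pc : P c = (-2 : ℝ) • b) (Qc : Q c = 0) (Pb : P b = (-2 : ℝ) • a)
    (Qb : Q b = 0) (Pa : P a = e₁) (Qa : Q a = e₂) (Qe₂ : Q e₂ = P e₁) (Qe₁ : Q e₁ = -P e₂) :
    P e₁ = 0 ∧ Q e₁ = T a ∧ P e₂ = -T a ∧ Q e₂ = 0 ∧ P (T a) = 0 ∧ Q (T a) = 0 := by
  have Tc : T c = 0 := by
    have h := hPQ c
    rw [Qc, Pc, map_smul, Qb, map_zero] at h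
    linear_combination (norm := module) (1 / 2 : ℝ) • h
  have Tb : T b = -e₂ := by
    have h := hPQ b
    rw [Qb, Pb, map_smul, Qa, map_zero] at h
    linear_combination (norm := module) (1 / 2 : ℝ) • h
  -- `Q` commutes with `T`, so `-Q e₂ = Q (T b) = T (Q b) = 0`.
  have QQ : Q e₂ = 0 := by
    have h := hQT b
    rw [Qb, Tb, map_zero, map_neg] at h
    linear_combination (norm := module) (-1 : ℝ) • h
  have PP : P e₁ = 0 := by rw [← Qe₂, QQ]
  have Pe₂ : P e₂ = -T a := by
    have h := hPQ a
    rw [Pa, Qa, Qe₁] at h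
    linear_combination (norm := module) (1 / 2 : ℝ) • h
  have Qe₁' : Q e₁ = T a := by rw [Qe₁, Pe₂, neg_neg]
  have Te₁ : T e₁ = (-1 / 2 : ℝ) • P (T a) := by
    have h := hPQ e₁
    rw [PP, Qe₁', map_zero] at h
    linear_combination (norm := module) (1 / 2 : ℝ) • h
  have Te₂ : T e₂ = (-1 / 2 : ℝ) • Q (T a) := by
    have h := hPQ e₂
    rw [QQ, Pe₂, map_zero, map_neg] at h
    linear_combination (norm := module) (1 / 2 : ℝ) • h
  -- Two evaluations of the same function: `Q (T a) = T (Q a) = T e₂ = -½ Q (T a)`.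
  have Qg : Q (T a) = 0 := by
    have h := hQT a
    rw [Qa, Te₂] at h
    linear_combination (norm := module) (2 / 3 : ℝ) • h
  have Sa : S a = (3 / 4 : ℝ) • P (T a) := by
    have h := hPT a
    rw [Pa, Te₁] at h
    linear_combination (norm := module) (-1 / 2 : ℝ) • h
  have Sb : S b = (3 / 2 : ℝ) • T a := by
    have h := hPT b
    rw [Pb, Tb, map_neg, map_smul, Pe₂] at h
    linear_combination (norm := module) (-1 / 2 : ℝ) • h
  have Sc : S c = -e₂ := by
    have h := hPT c
    rw [Pc, Tc, map_zero, map_smul, Tb] at h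
    linear_combination (norm := module) (-1 / 2 : ℝ) • h
  have Rc : R c = (2 : ℝ) • T a := by
    have h := hPS c
    rw [Pc, Sc, map_neg, map_smul, Sb, Pe₂] at h
    linear_combination (norm := module) (-1 / 2 : ℝ) • h
  have Rb : R b = (3 / 2 : ℝ) • P (T a) := by
    have h := hPS b
    rw [Pb, Sb, map_smul, map_smul, Sa] at h
    linear_combination (norm := module) (-1 / 2 : ℝ) • h
  -- The relation `[P, R] = 0` closes the system: `P (R c) = 2 P (T a)`, whereas `R (P c) = -2 R b =
  -- -3 P (T a)`.
  have Pg : P (T a) = 0 := by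
    have h := hPR c
    rw [Pc, Rc, map_smul, map_smul, Rb] at h
    linear_combination (norm := module) (1 / 5 : ℝ) • h
  exact ⟨PP, Qe₁', Pe₂, QQ, Pg, Qg⟩

/-! ### The left invariant frame in the chart -/

section Frame

/-- The first coordinate direction `P`. -/
def fieldP (_ : ℝ) : Fin 5 → ℝ := ![1, 0, 0, 0, 0]

/-- The field `Q`, corresponding to `J P`, as a function of the first coordinate. -/
def fieldQ (x : ℝ) : Fin 5 → ℝ := ![0, 1, -4 * x, -8 * x ^ 2, -16 * x ^ 3]

/-- The field `T = -[P, Q] / 2`, as a function of the first coordinate. -/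
def fieldT (x : ℝ) : Fin 5 → ℝ := ![0, 0, 2, 8 * x, 24 * x ^ 2]

/-- The field `S = [P, T] / 2`, as a function of the first coordinate. -/
def fieldS (x : ℝ) : Fin 5 → ℝ := ![0, 0, 0, 4, 24 * x]

/-- The field `R = [P, S] / 2`. -/
def fieldR (_ : ℝ) : Fin 5 → ℝ := ![0, 0, 0, 0, 12]

theorem hasDerivAt_fieldP (x : ℝ) : HasDerivAt fieldP 0 x := hasDerivAt_const _ _

theorem hasDerivAt_fieldR (x : ℝ) : HasDerivAt fieldR 0 x := hasDerivAt_const _ _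

theorem hasDerivAt_fieldQ (x : ℝ) :
    HasDerivAt fieldQ ![0, 0, -4, -16 * x, -48 * x ^ 2] x := by
  have h := hasDerivAt_id x
  rw [hasDerivAt_pi]
  intro i
  fin_cases i
  · exact hasDerivAt_const _ _
  · exact hasDerivAt_const _ _
  · exact (h.const_mul (-4)).congr_deriv (by simp)
  · exact ((h.pow 2).const_mul (-8)).congr_deriv (by simp; ring)
  · exact ((h.pow 3).const_mul (-16)).congr_deriv (by simp; ring)

theorem hasDerivAt_fieldT (x : ℝ) : HasDerivAt fieldT ![0, 0, 0, 8, 48 * x] x := by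
  have h := hasDerivAt_id x
  rw [hasDerivAt_pi]
  intro i
  fin_cases i
  · exact hasDerivAt_const _ _
  · exact hasDerivAt_const _ _
  · exact hasDerivAt_const _ _
  · exact (h.const_mul 8).congr_deriv (by simp)
  · exact ((h.pow 2).const_mul 24).congr_deriv (by simp; ring)

theorem hasDerivAt_fieldS (x : ℝ) : HasDerivAt fieldS ![0, 0, 0, 0, 24] x := by
  have h := hasDerivAt_id x
  rw [hasDerivAt_pi]
  intro i
  fin_cases i
  · exact hasDerivAt_const _ _
  · exact hasDerivAt_const _ _
  · exact hasDerivAt_const _ _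
  · exact hasDerivAt_const _ _
  · exact (h.const_mul 24).congr_deriv (by simp)

theorem contDiff_field {v : ℝ → Fin 5 → ℝ} (hv : ContDiff ℝ ∞ v) :
    ContDiff ℝ ∞ fun e : Fin 5 → ℝ => v (e 0) :=
  hv.comp (contDiff_apply ℝ ℝ 0)

theorem contDiff_fieldP : ContDiff ℝ ∞ fieldP := contDiff_const

theorem contDiff_fieldR : ContDiff ℝ ∞ fieldR := contDiff_const

theorem contDiff_fieldQ : ContDiff ℝ ∞ fieldQ := by
  rw [contDiff_pi]
  intro i
  fin_cases i <;> simp [fieldQ] <;> fun_prop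

theorem contDiff_fieldT : ContDiff ℝ ∞ fieldT := by
  rw [contDiff_pi]
  intro i
  fin_cases i <;> simp [fieldT] <;> fun_prop

theorem contDiff_fieldS : ContDiff ℝ ∞ fieldS := by
  rw [contDiff_pi]
  intro i
  fin_cases i <;> simp [fieldS] <;> fun_prop

variable {Ω : Set (Fin 5 → ℝ)}

theorem fderiv_field {v : ℝ → Fin 5 → ℝ} {v' : Fin 5 → ℝ} {e : Fin 5 → ℝ}
    (hv : HasDerivAt v v' (e 0)) (w : Fin 5 → ℝ) :
    fderiv ℝ (fun e : Fin 5 → ℝ => v (e 0)) e w = w 0 • v' := by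
  have h : HasFDerivAt (fun e : Fin 5 → ℝ => v (e 0)) _ e :=
    hv.hasFDerivAt.comp e
      (ContinuousLinearMap.proj (R := ℝ) (φ := fun _ : Fin 5 => ℝ) 0).hasFDerivAt
  rw [h.fderiv]
  simp

/-- The frame fields depend on the first coordinate only, so their bracket involves only ordinary
derivatives and first components. -/
theorem field_commutator (hΩ : IsOpen Ω) {v u z : ℝ → Fin 5 → ℝ} (hv : ContDiff ℝ ∞ v)
    (hu : ContDiff ℝ ∞ u) (hz : ContDiff ℝ ∞ z) (c : ℝ) {v' u' : ℝ → Fin 5 → ℝ}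
    (dv : ∀ x, HasDerivAt v (v' x) x) (du : ∀ x, HasDerivAt u (u' x) x)
    (h : ∀ x, u x 0 • v' x - v x 0 • u' x = c • z x) (f : smoothFun Ω) :
    alongField hΩ (contDiff_field hu) (alongField hΩ (contDiff_field hv) f) -
      alongField hΩ (contDiff_field hv) (alongField hΩ (contDiff_field hu) f) =
      c • alongField hΩ (contDiff_field hz) f :=
  alongField_commutator hΩ _ _ _ c (fun p _ => by
    rw [fderiv_field (dv _), fderiv_field (du _), h]) f

/-- Differentiation along `P`. -/
noncomputable def opP (hΩ : IsOpen Ω) := alongField hΩ (contDiff_field contDiff_fieldP)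

/-- Differentiation along `Q`. -/
noncomputable def opQ (hΩ : IsOpen Ω) := alongField hΩ (contDiff_field contDiff_fieldQ)

/-- Differentiation along `T`. -/
noncomputable def opT (hΩ : IsOpen Ω) := alongField hΩ (contDiff_field contDiff_fieldT)

/-- Differentiation along `S`. -/
noncomputable def opS (hΩ : IsOpen Ω) := alongField hΩ (contDiff_field contDiff_fieldS)

/-- Differentiation along `R`. -/
noncomputable def opR (hΩ : IsOpen Ω) := alongField hΩ (contDiff_field contDiff_fieldR)

theorem opP_opQ (hΩ : IsOpen Ω) (u : smoothFun Ω) :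
    opP hΩ (opQ hΩ u) - opQ hΩ (opP hΩ u) = (-2 : ℝ) • opT hΩ u :=
  field_commutator hΩ contDiff_fieldQ contDiff_fieldP contDiff_fieldT _
    hasDerivAt_fieldQ hasDerivAt_fieldP (fun x => by
    ext i; fin_cases i <;> simp [fieldP, fieldT] <;> ring) u

theorem opP_opT (hΩ : IsOpen Ω) (u : smoothFun Ω) :
    opP hΩ (opT hΩ u) - opT hΩ (opP hΩ u) = (2 : ℝ) • opS hΩ u :=
  field_commutator hΩ contDiff_fieldT contDiff_fieldP contDiff_fieldS _
    hasDerivAt_fieldT hasDerivAt_fieldP (fun x => by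
    ext i; fin_cases i <;> simp [fieldP, fieldS] <;> ring) u

theorem opP_opS (hΩ : IsOpen Ω) (u : smoothFun Ω) :
    opP hΩ (opS hΩ u) - opS hΩ (opP hΩ u) = (2 : ℝ) • opR hΩ u :=
  field_commutator hΩ contDiff_fieldS contDiff_fieldP contDiff_fieldR _
    hasDerivAt_fieldS hasDerivAt_fieldP (fun x => by
    ext i; fin_cases i <;> simp [fieldP, fieldR]; norm_num) u

theorem opP_opR (hΩ : IsOpen Ω) (u : smoothFun Ω) :
    opP hΩ (opR hΩ u) - opR hΩ (opP hΩ u) = (0 : ℝ) • opR hΩ u :=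
  field_commutator hΩ contDiff_fieldR contDiff_fieldP contDiff_fieldR _
    hasDerivAt_fieldR hasDerivAt_fieldP (fun x => by simp) u

theorem opQ_opT (hΩ : IsOpen Ω) (u : smoothFun Ω) :
    opQ hΩ (opT hΩ u) - opT hΩ (opQ hΩ u) = (0 : ℝ) • opR hΩ u :=
  field_commutator hΩ contDiff_fieldT contDiff_fieldQ contDiff_fieldR _
    hasDerivAt_fieldT hasDerivAt_fieldQ (fun x => by
    simp [fieldQ, fieldT]) u

theorem eq_frame_combination (x : ℝ) (w : Fin 5 → ℝ) : ∃ k₁ k₂ k₃ : ℝ,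
    w = w 0 • fieldP x + w 1 • fieldQ x + k₁ • fieldT x + k₂ • fieldS x + k₃ • fieldR x := by
  -- The system for the vertical coefficients is triangular; each witness substitutes the preceding
  -- ones.
  refine ⟨(w 2 + 4 * x * w 1) / 2, (w 3 + 8 * x ^ 2 * w 1 - 8 * x * ((w 2 + 4 * x * w 1) / 2)) / 4,
    (w 4 + 16 * x ^ 3 * w 1 - 24 * x ^ 2 * ((w 2 + 4 * x * w 1) / 2)
      - 24 * x * ((w 3 + 8 * x ^ 2 * w 1 - 8 * x * ((w 2 + 4 * x * w 1) / 2)) / 4)) / 12, ?_⟩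
  ext i
  fin_cases i <;> simp [fieldP, fieldQ, fieldT, fieldS, fieldR] <;> ring

/-! ### Integration of the overdetermined system -/

/-- `P` and `Q` are bracket generating: a function annihilated by both is annihilated by `T`, `S`
and `R`, hence has zero derivative. -/
theorem exists_const_of_opP_opQ (hΩ : IsOpen Ω) (hc : IsPreconnected Ω) {f : smoothFun Ω}
    (hP : opP hΩ f = 0) (hQ : opQ hΩ f = 0) : ∃ k, ∀ e ∈ Ω, f.1 e = k := by
  have hT : opT hΩ f = 0 := by
    have h := opP_opQ hΩ f
    rw [hP, hQ, map_zero, map_zero, sub_zero] at h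
    simpa using h.symm
  have hS : opS hΩ f = 0 := by
    have h := opP_opT hΩ f
    rw [hP, hT, map_zero, map_zero, sub_zero] at h
    simpa using h.symm
  have hR : opR hΩ f = 0 := by
    have h := opP_opS hΩ f
    rw [hP, hS, map_zero, map_zero, sub_zero] at h
    simpa using h.symm
  have key : ∀ {v : ℝ → Fin 5 → ℝ} (hv : ContDiff ℝ ∞ v),
      alongField hΩ (contDiff_field hv) f = 0 → ∀ e ∈ Ω, fderiv ℝ f.1 e (v (e 0)) = 0 := by
    intro v hv h e he
    rw [← alongField_apply hΩ (contDiff_field hv) f he, h]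
    rfl
  refine hΩ.exists_is_const_of_fderiv_eq_zero hc
    (fun e he => (hasFDerivAt_smoothFun hΩ f he).differentiableAt.differentiableWithinAt) ?_
  intro e he
  ext w
  obtain ⟨k₁, k₂, k₃, hw⟩ := eq_frame_combination (e 0) w
  rw [hw]
  simp only [map_add, map_smul, key contDiff_fieldP hP e he, key contDiff_fieldQ hQ e he,
    key contDiff_fieldT hT e he, key contDiff_fieldS hS e he, key contDiff_fieldR hR e he]
  simp

/-- The integration tool: a function is determined up to a constant once a primitive `g` with the
same derivatives along `P` and `Q` has been guessed. -/
theorem exists_const_of_opP_opQ_eq (hΩ : IsOpen Ω) (hc : IsPreconnected Ω) {f : smoothFun Ω}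
    {g : (Fin 5 → ℝ) → ℝ} (hg : ContDiff ℝ ∞ g)
    (hP : ∀ e ∈ Ω, (opP hΩ f).1 e = fderiv ℝ g e (fieldP (e 0)))
    (hQ : ∀ e ∈ Ω, (opQ hΩ f).1 e = fderiv ℝ g e (fieldQ (e 0))) :
    ∃ k, ∀ e ∈ Ω, f.1 e = g e + k := by
  have hgo : ContDiffOn ℝ ∞ g Ω := hg.contDiffOn
  have key : ∀ {v : ℝ → Fin 5 → ℝ} (hv : ContDiff ℝ ∞ v),
      (∀ e ∈ Ω, (alongField hΩ (contDiff_field hv) f).1 e = fderiv ℝ g e (v (e 0))) →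
      alongField hΩ (contDiff_field hv) (f - restrictFun g hgo) = 0 := by
    intro v hv h
    rw [map_sub, sub_eq_zero]
    refine smoothFun_ext fun e he => ?_
    rw [h e he, alongField_apply _ _ _ he, fderiv_restrictFun hΩ hgo he]
  obtain ⟨k, hk⟩ := exists_const_of_opP_opQ hΩ hc (key contDiff_fieldP hP)
    (key contDiff_fieldQ hQ)
  refine ⟨k, fun e he => ?_⟩
  have h : f.1 e - (restrictFun g hgo).1 e = k := hk e he
  rw [restrictFun_apply _ he] at h
  linarith

theorem hasFDerivAt_proj (i : Fin 5) (e : Fin 5 → ℝ) :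
    HasFDerivAt (fun e : Fin 5 → ℝ => e i)
      (ContinuousLinearMap.proj (R := ℝ) (φ := fun _ : Fin 5 => ℝ) i) e :=
  (ContinuousLinearMap.proj (R := ℝ) (φ := fun _ : Fin 5 => ℝ) i).hasFDerivAt

/-- The solutions of the overdetermined system. -/
theorem exists_solution_parameters (hΩ : IsOpen Ω) (hc : IsPreconnected Ω)
    {a b c e₁ e₂ : smoothFun Ω} (Pc : opP hΩ c = (-2 : ℝ) • b) (Qc : opQ hΩ c = 0)
    (Pb : opP hΩ b = (-2 : ℝ) • a) (Qb : opQ hΩ b = 0) (Pa : opP hΩ a = e₁)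
    (Qa : opQ hΩ a = e₂) (Qe₂ : opQ hΩ e₂ = opP hΩ e₁) (Qe₁ : opQ hΩ e₁ = -opP hΩ e₂) :
    ∃ r s t k₁ k₂ k₃ : ℝ, ∀ e ∈ Ω,
      e₁.1 e = 2 * (r * e 1 + t) ∧ e₂.1 e = -2 * (r * e 0 + s) ∧
      a.1 e = r * (e 2 + 2 * e 0 * e 1) - 2 * s * e 1 + 2 * t * e 0 + k₁ / 2 ∧
      b.1 e = r * (3 / 4 * e 3 - 2 * e 0 * e 2 - 2 * e 0 ^ 2 * e 1) - 2 * t * e 0 ^ 2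
        + s * (4 * e 0 * e 1 + e 2) - k₁ * e 0 + k₂ / 4 ∧
      c.1 e = r * (e 4 / 3 - 3 / 2 * e 0 * e 3 + 2 * e 0 ^ 2 * e 2 + 4 / 3 * e 0 ^ 3 * e 1)
        + 4 / 3 * t * e 0 ^ 3 + s * (e 3 / 2 - 2 * e 0 * e 2 - 4 * e 0 ^ 2 * e 1)
        + k₁ * e 0 ^ 2 - k₂ / 2 * e 0 + k₃ / 12 := by
  obtain ⟨Pe₁, Qe₁', Pe₂, Qe₂', Pg, Qg⟩ := prolongation (opP hΩ) (opQ hΩ) (opT hΩ) (opS hΩ)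
    (opR hΩ) (opP_opQ hΩ) (opP_opT hΩ) (opP_opS hΩ) (opP_opR hΩ) (opQ_opT hΩ)
    Pc Qc Pb Qb Pa Qa Qe₂ Qe₁
  have d := hasFDerivAt_proj
  -- The constant `g` is `T a`. Polynomial primitives for `e₁, e₂, a, b, c` follow in this order,
  -- each using the earlier ones.
  obtain ⟨g, hg⟩ := exists_const_of_opP_opQ hΩ hc Pg Qg
  obtain ⟨t, ht⟩ := exists_const_of_opP_opQ_eq hΩ hc (f := e₁) (g := fun e => g * e 1)
    (by fun_prop)
    (fun e he => by rw [Pe₁, ((d 1 e).const_mul g).fderiv]; simp [fieldP])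
    (fun e he => by rw [Qe₁', hg e he, ((d 1 e).const_mul g).fderiv]; simp [fieldQ])
  obtain ⟨s, hs⟩ := exists_const_of_opP_opQ_eq hΩ hc (f := e₂) (g := fun e => -g * e 0)
    (by fun_prop)
    (fun e he => by
      rw [Pe₂, ((d 0 e).const_mul (-g)).fderiv]
      simp [fieldP, hg e he])
    (fun e he => by rw [Qe₂', ((d 0 e).const_mul (-g)).fderiv]; simp [fieldQ])
  have da := fun e => ((((d 2 e).add (((d 0 e).mul (d 1 e)).const_mul 2)).const_mul
    (g / 2)).add ((d 1 e).const_mul s)).add ((d 0 e).const_mul t)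
  obtain ⟨k₁, h₁⟩ := exists_const_of_opP_opQ_eq hΩ hc (f := a)
    (g := fun e => g / 2 * (e 2 + 2 * (e 0 * e 1)) + s * e 1 + t * e 0)
    (by fun_prop)
    (fun e he => by
      rw [Pa, ht e he]
      refine Eq.trans ?_ (congrArg (· (fieldP (e 0))) (da e).fderiv).symm
      simp [fieldP]; ring)
    (fun e he => by
      rw [Qa, hs e he]
      refine Eq.trans ?_ (congrArg (· (fieldQ (e 0))) (da e).fderiv).symm
      simp [fieldQ]; ring)
  have db := fun e => ((((((d 3 e).const_mul (3 / 4)).sub (((d 0 e).mul (d 2 e)).const_mul 2)).sub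
    ((((d 0 e).pow 2).mul (d 1 e)).const_mul 2)).const_mul (g / 2)).sub
    (((d 0 e).pow 2).const_mul t)).sub
    (((((d 0 e).mul (d 1 e)).const_mul 4).add (d 2 e)).const_mul (s / 2))
  have db' := fun e => (db e).sub ((d 0 e).const_mul (2 * k₁))
  obtain ⟨k₂, h₂⟩ := exists_const_of_opP_opQ_eq hΩ hc (f := b)
    (g := fun e => g / 2 * (3 / 4 * e 3 - 2 * (e 0 * e 2) - 2 * (e 0 ^ 2 * e 1)) - t * e 0 ^ 2
      - s / 2 * (4 * (e 0 * e 1) + e 2) - 2 * k₁ * e 0)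
    (by fun_prop)
    (fun e he => by
      rw [Pb]
      refine Eq.trans ?_ (congrArg (· (fieldP (e 0))) (db' e).fderiv).symm
      simp [fieldP, h₁ e he]; ring)
    (fun e he => by
      rw [Qb]
      refine Eq.trans ?_ (congrArg (· (fieldQ (e 0))) (db' e).fderiv).symm
      simp [fieldQ, -zero_eq_mul, -mul_eq_zero]; ring)
  have dc := fun e => ((((((d 4 e).const_mul (1 / 3)).sub
    (((d 0 e).mul (d 3 e)).const_mul (3 / 2))).add
    ((((d 0 e).pow 2).mul (d 2 e)).const_mul 2)).add
    ((((d 0 e).pow 3).mul (d 1 e)).const_mul (4 / 3))).const_mul (g / 2)).add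
    (((d 0 e).pow 3).const_mul (2 / 3 * t))
  have dc' := fun e => (dc e).sub (((((d 3 e).const_mul (1 / 2)).sub
    (((d 0 e).mul (d 2 e)).const_mul 2)).sub
    ((((d 0 e).pow 2).mul (d 1 e)).const_mul 4)).const_mul (s / 2))
  have dc'' := fun e => ((dc' e).add (((d 0 e).pow 2).const_mul (2 * k₁))).sub
    ((d 0 e).const_mul (2 * k₂))
  obtain ⟨k₃, h₃⟩ := exists_const_of_opP_opQ_eq hΩ hc (f := c)
    (g := fun e => g / 2 * (1 / 3 * e 4 - 3 / 2 * (e 0 * e 3) + 2 * (e 0 ^ 2 * e 2)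
        + 4 / 3 * (e 0 ^ 3 * e 1)) + 2 / 3 * t * e 0 ^ 3
      - s / 2 * (1 / 2 * e 3 - 2 * (e 0 * e 2) - 4 * (e 0 ^ 2 * e 1)) + 2 * k₁ * e 0 ^ 2
      - 2 * k₂ * e 0)
    (by fun_prop)
    (fun e he => by
      rw [Pc]
      refine Eq.trans ?_ (congrArg (· (fieldP (e 0))) (dc'' e).fderiv).symm
      simp [fieldP, h₂ e he]; ring)
    (fun e he => by
      rw [Qc]
      refine Eq.trans ?_ (congrArg (· (fieldQ (e 0))) (dc'' e).fderiv).symm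
      simp [fieldQ]; ring)
  -- The rescaling matches the parameters of `holField`: `e₁` and `e₂` are `2 Im f` and `-2 Re f`,
  -- and `2, 4, 12` are the leading coefficients of `T, S, R`.
  refine ⟨g / 2, -s / 2, t / 2, 2 * k₁, 4 * k₂, 12 * k₃, fun e he => ⟨?_, ?_, ?_, ?_, ?_⟩⟩
  · rw [ht e he]; ring
  · rw [hs e he]; ring
  · rw [h₁ e he]; ring
  · rw [h₂ e he]; ring
  · rw [h₃ e he]; ring

end Frame

/-! ### The infinitesimal CR automorphisms -/

/-- The holomorphic vector fields whose restrictions to `N` are the infinitesimal CR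
automorphisms. -/
noncomputable def holField (θ : Fin 6 → ℝ) (p : Fin 4 → ℂ) : Fin 4 → ℂ :=
  ![(θ 0 : ℂ) * p 0 + ((θ 1 : ℂ) + Complex.I * (θ 2 : ℂ)),
    2 * (θ 0 : ℂ) * p 1 + (2 * Complex.I * (θ 1 : ℂ) + 2 * (θ 2 : ℂ)) * p 0 + (θ 3 : ℂ),
    3 * (θ 0 : ℂ) * p 2 + (2 * Complex.I * (θ 1 : ℂ) + 2 * (θ 2 : ℂ)) * p 0 ^ 2
      + 4 * (θ 1 : ℂ) * p 1 + (θ 4 : ℂ),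
    4 * (θ 0 : ℂ) * p 3 + (2 * Complex.I * (θ 1 : ℂ) + 2 * (θ 2 : ℂ)) * p 0 ^ 3
      + 6 * (θ 1 : ℂ) * p 2 + (θ 5 : ℂ)]

/-- The field `holField θ` in the chart. -/
def chartField (θ : Fin 6 → ℝ) (e : Fin 5 → ℝ) : Fin 5 → ℝ :=
  ![θ 0 * e 0 + θ 1, θ 0 * e 1 + θ 2, 2 * θ 0 * e 2 - 4 * θ 1 * e 1 + θ 3,
    3 * θ 0 * e 3 + 4 * θ 1 * e 2 + θ 4, 4 * θ 0 * e 4 + 6 * θ 1 * e 3 + θ 5]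

theorem contDiff_holField (θ : Fin 6 → ℝ) : ContDiff ℝ ∞ (holField θ) := by
  have h : ∀ i : Fin 4, ContDiff ℝ ∞ fun p : Fin 4 → ℂ => p i := fun i => contDiff_apply ℝ ℂ i
  have h0 := h 0
  have h1 := h 1
  have h2 := h 2
  have h3 := h 3
  rw [contDiff_pi]
  intro i
  fin_cases i <;> simp only [holField] <;> simp <;> fun_prop

theorem fderiv_holField_apply (θ : Fin 6 → ℝ) (p v : Fin 4 → ℂ) : fderiv ℝ (holField θ) p v =
    ![(θ 0 : ℂ) * v 0,
      2 * (θ 0 : ℂ) * v 1 + (2 * Complex.I * (θ 1 : ℂ) + 2 * (θ 2 : ℂ)) * v 0,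
      3 * (θ 0 : ℂ) * v 2 + (2 * Complex.I * (θ 1 : ℂ) + 2 * (θ 2 : ℂ)) * (2 * p 0 * v 0)
        + 4 * (θ 1 : ℂ) * v 1,
      4 * (θ 0 : ℂ) * v 3 + (2 * Complex.I * (θ 1 : ℂ) + 2 * (θ 2 : ℂ)) * (3 * p 0 ^ 2 * v 0)
        + 6 * (θ 1 : ℂ) * v 2] := by
  have hd := (contDiff_holField θ).differentiable (by simp) p
  have h : ∀ i : Fin 4, HasFDerivAt (fun p : Fin 4 → ℂ => p i)
      (ContinuousLinearMap.proj (R := ℝ) (φ := fun _ : Fin 4 => ℂ) i) p := fun i =>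
    (ContinuousLinearMap.proj (R := ℝ) (φ := fun _ : Fin 4 => ℂ) i).hasFDerivAt
  funext i
  fin_cases i
  · refine (fderiv_apply_pi hd (((h 0).const_mul _).add_const _) (fun _ => rfl) v).trans ?_
    simp
  · refine (fderiv_apply_pi hd ((((h 1).const_mul _).add ((h 0).const_mul _)).add_const _)
      (fun _ => rfl) v).trans ?_
    simp
  · refine (fderiv_apply_pi hd (((((h 2).const_mul _).add (((h 0).pow 2).const_mul _)).add
      ((h 1).const_mul _)).add_const _) (fun _ => rfl) v).trans ?_
    simp
  · refine (fderiv_apply_pi hd (((((h 3).const_mul _).add (((h 0).pow 3).const_mul _)).add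
      ((h 2).const_mul _)).add_const _) (fun _ => rfl) v).trans ?_
    simp

theorem chartField_complex (θ : Fin 6 → ℝ) (e : Fin 5 → ℝ) :
    (chartField θ e 0 : ℂ) + Complex.I * (chartField θ e 1 : ℂ) =
      (θ 0 : ℂ) * zc e + ((θ 1 : ℂ) + Complex.I * (θ 2 : ℂ)) := by
  simp [chartField, zc]
  ring

/-- Eliminates `y`, so that tangency becomes a polynomial identity in `x`, `z` and `i`. -/
theorem coord_one_eq (e : Fin 5 → ℝ) : (e 1 : ℂ) = -Complex.I * (zc e - (e 0 : ℂ)) := by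
  simp only [zc]
  linear_combination (e 1 : ℂ) * Complex.I_mul_I

/-- The source of tangency: along `N` the holomorphic field is the image of a real field in the
chart. -/
theorem holField_chart (θ : Fin 6 → ℝ) (e : Fin 5 → ℝ) :
    holField θ (chart e) = dchart e (chartField θ e) := by
  rw [dchart_apply, chartField_complex]
  have hy := coord_one_eq e
  funext i
  fin_cases i
  · simp [holField, chart, crVec]
  · simp [holField, chart, crVec, chartField, hy]
    linear_combination (-(θ 2 : ℂ) * (4 * (e 0 : ℂ) - 2 * zc e)) * Complex.I_mul_I
  · simp [holField, chart, crVec, chartField, hy]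
    linear_combination (-(θ 2 : ℂ) * (8 * (e 0 : ℂ) ^ 2 - 2 * zc e ^ 2)) * Complex.I_mul_I
  · simp [holField, chart, crVec, chartField, hy]
    linear_combination (-(θ 2 : ℂ) * (16 * (e 0 : ℂ) ^ 3 - 2 * zc e ^ 3)) * Complex.I_mul_I

/-- In bracket form, `[holField θ, crVec] = -θ₀ crVec`: only the dilation rescales the complex
tangent frame. -/
theorem fderiv_crVec_chartField (θ : Fin 6 → ℝ) (e : Fin 5 → ℝ) :
    fderiv ℝ crVec e (chartField θ e) =
      fderiv ℝ (holField θ) (chart e) (crVec e) - (θ 0 : ℂ) • crVec e := by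
  rw [fderiv_crVec_apply, fderiv_holField_apply, chartField_complex]
  funext i
  fin_cases i
  · simp [crVec]
  · simp [crVec, chartField]
    linear_combination (-2 * (θ 2 : ℂ)) * Complex.I_mul_I
  · simp [crVec, chartField, chart]
    linear_combination (-4 * (θ 2 : ℂ) * zc e) * Complex.I_mul_I
  · simp [crVec, chartField, chart]
    linear_combination (-6 * (θ 2 : ℂ) * zc e ^ 2) * Complex.I_mul_I

/-- This complex linearity is the holomorphy of the field, and makes its bracket compatible with
`J`. -/
theorem fderiv_holField_smul (θ : Fin 6 → ℝ) (p v : Fin 4 → ℂ) (k : ℂ) :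
    fderiv ℝ (holField θ) p (k • v) = k • fderiv ℝ (holField θ) p v := by
  rw [fderiv_holField_apply, fderiv_holField_apply]
  funext i
  fin_cases i <;> simp <;> ring

/-! ### The polynomial fields are infinitesimal CR automorphisms -/

section Local

variable {W : Set (Fin 4 → ℂ)} {e : Fin 5 → ℝ} {X Z : (Fin 4 → ℂ) → (Fin 4 → ℂ)}

theorem isOpen_chart_preimage (hW : IsOpen W) : IsOpen (chart ⁻¹' W) :=
  hW.preimage contDiff_chart.continuous

theorem chart_mem_inter (he : chart e ∈ W) : chart e ∈ modelN ∩ W := ⟨chart_mem e, he⟩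

theorem bracket_chart (hW : IsOpen W) (he : chart e ∈ W) (hX : IsVectorField (modelN ∩ W) X)
    (hZ : IsVectorField (modelN ∩ W) Z) {w v : Fin 5 → ℝ} (hw : X (chart e) = dchart e w)
    (hv : Z (chart e) = dchart e v) :
    bracket (modelN ∩ W) X Z (chart e) =
      fderiv ℝ (Z ∘ chart) e w - fderiv ℝ (X ∘ chart) e v := by
  rw [bracket_apply (chart_mem_inter he), (hX.hasFDerivAt_chart hW he).fderiv,
    (hZ.hasFDerivAt_chart hW he).fderiv, hw, hv]
  rfl

/-- The restriction of `holField θ` to an open subset of `N`. -/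
noncomputable def restrictHol (W : Set (Fin 4 → ℂ)) (θ : Fin 6 → ℝ) : (Fin 4 → ℂ) → (Fin 4 → ℂ) :=
  (modelN ∩ W).indicator (holField θ)

theorem restrictHol_chart (θ : Fin 6 → ℝ) (he : chart e ∈ W) :
    restrictHol W θ (chart e) = holField θ (chart e) :=
  Set.indicator_of_mem (chart_mem_inter he) _

theorem exists_chart_eq {p : Fin 4 → ℂ} (hp : p ∈ modelN ∩ W) : ∃ e, chart e ∈ W ∧ chart e = p :=
  ⟨chartInv p, by rw [chart_chartInv hp.1]; exact hp.2, chart_chartInv hp.1⟩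

theorem isVectorField_restrictHol (hW : IsOpen W) (θ : Fin 6 → ℝ) :
    IsVectorField (modelN ∩ W) (restrictHol W θ) where
  smooth := (contDiff_holField θ).contDiffOn.congr fun _ hp => Set.indicator_of_mem hp _
  tangent p hp := by
    obtain ⟨e, he, rfl⟩ := exists_chart_eq hp
    rw [restrictHol_chart θ he, holField_chart]
    exact dchart_mem_tangentSp hW he _
  zero_off p hp := Set.indicator_of_notMem hp _

theorem fderiv_restrictHol_chart (hW : IsOpen W) (θ : Fin 6 → ℝ) (he : chart e ∈ W)
    (v : Fin 5 → ℝ) : fderiv ℝ (restrictHol W θ ∘ chart) e v =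
      fderiv ℝ (holField θ) (chart e) (dchart e v) := by
  have h1 : restrictHol W θ ∘ chart =ᶠ[nhds e] holField θ ∘ chart :=
    Filter.eventually_of_mem ((isOpen_chart_preimage hW).mem_nhds he)
      fun x hx => restrictHol_chart θ hx
  have h2 : HasFDerivAt (holField θ ∘ chart) _ e :=
    ((contDiff_holField θ).differentiable (by simp) (chart e)).hasFDerivAt.comp e
      (hasFDerivAt_chart e)
  rw [h1.fderiv_eq, h2.fderiv]
  rfl

/-- Leibniz rule for `Z = Z₀ • crVec`, combined with `fderiv_crVec_chartField`. The resulting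
coefficient of `crVec` is complex linear in `Z`, so both CR conditions can be read off. -/
theorem bracket_restrictHol (hW : IsOpen W) (he : chart e ∈ W) (θ : Fin 6 → ℝ)
    (hZ : IsComplexTangentField (modelN ∩ W) Z) :
    bracket (modelN ∩ W) (restrictHol W θ) Z (chart e) =
      (fderiv ℝ (Z ∘ chart) e (chartField θ e) 0 - (θ 0 : ℂ) * Z (chart e) 0) • crVec e := by
  have hZv : ∀ x ∈ chart ⁻¹' W, (Z ∘ chart) x = Z (chart x) 0 • crVec x := fun x hx =>
    eq_smul_crVec (hZ.complex_tangent _ ⟨chart_mem x, hx⟩)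
  obtain ⟨v, hv⟩ := exists_dchart_of_mem (hZ.tangent (chart e) (chart_mem_inter he))
  have h1 : HasFDerivAt (Z ∘ chart) (fderiv ℝ (Z ∘ chart) e) e :=
    (hZ.toIsVectorField.hasFDerivAt_chart hW he).differentiableAt.hasFDerivAt
  have h2 : HasFDerivAt (fun x => Z (chart x) 0) _ e := hasFDerivAt_pi'.1 h1 0
  have h3 : HasFDerivAt crVec _ e := (contDiff_crVec.differentiable (by simp) e).hasFDerivAt
  have h4 : Z ∘ chart =ᶠ[nhds e] fun x => Z (chart x) 0 • crVec x :=
    Filter.eventually_of_mem ((isOpen_chart_preimage hW).mem_nhds he) hZv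
  have h5 := congrArg (· (chartField θ e)) (h4.fderiv_eq.trans (h2.smul h3).fderiv)
  simp only [add_apply, smul_apply, ContinuousLinearMap.smulRight_apply,
    ContinuousLinearMap.comp_apply, ContinuousLinearMap.proj_apply] at h5
  have h6 : fderiv ℝ (holField θ) (chart e) (Z (chart e)) =
      Z (chart e) 0 • fderiv ℝ (holField θ) (chart e) (crVec e) := by
    rw [← fderiv_holField_smul]
    exact congrArg _ (hZv e he)
  rw [bracket_chart hW he (isVectorField_restrictHol hW θ) hZ.toIsVectorField
    ((restrictHol_chart θ he).trans (holField_chart θ e)) hv, fderiv_restrictHol_chart hW θ he,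
    ← hv]
  linear_combination (norm := module) h5 - h6 + Z (chart e) 0 • fderiv_crVec_chartField θ e

theorem isInfCRAut_restrictHol (hW : IsOpen W) (θ : Fin 6 → ℝ) :
    IsInfCRAut (modelN ∩ W) (restrictHol W θ) where
  toIsVectorField := isVectorField_restrictHol hW θ
  bracket_mem Z hZ p hp := by
    obtain ⟨e, he, rfl⟩ := exists_chart_eq hp
    rw [bracket_restrictHol hW he θ hZ]
    exact smul_crVec_mem hW he _
  bracket_I Z hZ p hp := by
    obtain ⟨e, he, rfl⟩ := exists_chart_eq hp
    have h1 := hZ.toIsVectorField.hasFDerivAt_chart hW he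
    rw [bracket_restrictHol hW he θ hZ, bracket_restrictHol hW he θ hZ.smul_I]
    have h2 : fderiv ℝ ((Complex.I • Z) ∘ chart) e = Complex.I • fderiv ℝ (Z ∘ chart) e := by
      rw [h1.fderiv]
      exact (h1.const_smul Complex.I).fderiv
    rw [h2, smul_smul]
    congr 1
    simp
    ring

end Local

/-! ### Local infinitesimal CR automorphisms -/

section Classification

variable {W : Set (Fin 4 → ℂ)} {e : Fin 5 → ℝ} {X : (Fin 4 → ℂ) → (Fin 4 → ℂ)}

theorem dchart_fieldP (e : Fin 5 → ℝ) : dchart e (fieldP (e 0)) = crVec e := by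
  rw [dchart_apply]
  funext i
  fin_cases i <;> simp [fieldP]

theorem dchart_fieldQ (e : Fin 5 → ℝ) : dchart e (fieldQ (e 0)) = Complex.I • crVec e := by
  rw [dchart_apply]
  funext i
  fin_cases i <;> simp [fieldQ]

/-- The section of the complex tangent bundle with value `crVec e` at `chart e`. -/
noncomputable def crField (W : Set (Fin 4 → ℂ)) : (Fin 4 → ℂ) → (Fin 4 → ℂ) :=
  (modelN ∩ W).indicator (crVec ∘ chartInv)

theorem crField_chart (he : chart e ∈ W) : crField W (chart e) = crVec e := by
  rw [crField, Set.indicator_of_mem (chart_mem_inter he), Function.comp_apply, chartInv_chart]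

theorem isComplexTangentField_crField (hW : IsOpen W) :
    IsComplexTangentField (modelN ∩ W) (crField W) := by
  have h : ∀ p ∈ modelN ∩ W, crField W p ∈ complexTangentSp (modelN ∩ W) p := by
    intro p hp
    obtain ⟨e, he, rfl⟩ := exists_chart_eq hp
    rw [crField_chart he, ← one_smul ℂ (crVec e)]
    exact smul_crVec_mem hW he 1
  exact ⟨⟨(contDiff_crVec.comp contDiff_chartInv).contDiffOn.congr
    fun _ hp => Set.indicator_of_mem hp _, fun p hp => (h p hp).1,
    fun p hp => Set.indicator_of_notMem hp _⟩, h⟩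

theorem fderiv_crField_chart (hW : IsOpen W) (he : chart e ∈ W) :
    fderiv ℝ (crField W ∘ chart) e = fderiv ℝ crVec e :=
  Filter.EventuallyEq.fderiv_eq (Filter.eventually_of_mem
    ((isOpen_chart_preimage hW).mem_nhds he) fun _ hx => crField_chart hx)

/-- The Cauchy-Riemann equations for an infinitesimal CR automorphism. -/
theorem IsInfCRAut.fderiv_chart (hW : IsOpen W) (he : chart e ∈ W)
    (hX : IsInfCRAut (modelN ∩ W) X) {w : Fin 5 → ℝ} (hw : X (chart e) = dchart e w) :
    fderiv ℝ (X ∘ chart) e (fieldP (e 0)) = fderiv ℝ crVec e w +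
        (fderiv ℝ (X ∘ chart) e (fieldP (e 0)) 0) • crVec e ∧
      fderiv ℝ (X ∘ chart) e (fieldQ (e 0)) =
        Complex.I • fderiv ℝ (X ∘ chart) e (fieldP (e 0)) := by
  have hZ := isComplexTangentField_crField hW
  have hd := hZ.toIsVectorField.hasFDerivAt_chart hW he
  have b1 := bracket_chart hW he hX.toIsVectorField hZ.toIsVectorField hw
    ((crField_chart he).trans (dchart_fieldP e).symm)
  have b2 := bracket_chart hW he hX.toIsVectorField hZ.smul_I.toIsVectorField hw
    (v := fieldQ (e 0)) (by rw [Pi.smul_apply, crField_chart he, dchart_fieldQ])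
  have hI : fderiv ℝ ((Complex.I • crField W) ∘ chart) e = Complex.I • fderiv ℝ crVec e := by
    rw [← fderiv_crField_chart hW he, hd.fderiv]
    exact (hd.const_smul Complex.I).fderiv
  rw [fderiv_crField_chart hW he] at b1
  rw [hI] at b2
  -- `crVec` has constant first component `1`, so the first component of the bracket determines its
  -- multiple of `crVec`.
  have h0 : fderiv ℝ crVec e w 0 = 0 := by rw [fderiv_crVec_apply]; rfl
  have m1 := eq_smul_crVec (hX.bracket_mem _ hZ _ (chart_mem_inter he))
  have m2 := hX.bracket_I _ hZ _ (chart_mem_inter he)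
  rw [b1] at m1
  rw [b1, b2] at m2
  rw [Pi.sub_apply, h0] at m1
  simp only [smul_apply] at m2
  constructor
  · linear_combination (norm := module) -m1
  · linear_combination (norm := module) -m2

/-- The part of a vector field along the last three coordinates. -/
noncomputable def vertPart (X : (Fin 4 → ℂ) → (Fin 4 → ℂ)) (e : Fin 5 → ℝ) : Fin 4 → ℂ :=
  X (chart e) - X (chart e) 0 • crVec e

/-- The entries are real because `X` is tangent, so later passages to real parts lose nothing. -/
theorem vertPart_eq {w : Fin 5 → ℝ} (hw : X (chart e) = dchart e w) : vertPart X e =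
    ![0, ((w 2 + 4 * e 0 * w 1 : ℝ) : ℂ), ((w 3 + 8 * e 0 ^ 2 * w 1 : ℝ) : ℂ),
      ((w 4 + 16 * e 0 ^ 3 * w 1 : ℝ) : ℂ)] := by
  rw [vertPart, hw, dchart_apply]
  funext i
  fin_cases i <;> simp [crVec]

theorem dchart_zero_apply (e w : Fin 5 → ℝ) :
    dchart e w 0 = (w 0 : ℂ) + Complex.I * (w 1 : ℂ) := by
  rw [dchart_apply]
  simp [crVec]

/-- The derivatives of `f = X₀` cancel by the Cauchy–Riemann equations. In the derivatives of
`crVec` the terms holomorphic in `z` cancel too, since `dz` takes the value `f` on `X`; only the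
dependence on `x` contributes. The common vector is half of `T`. -/
theorem IsInfCRAut.hasFDerivAt_vertPart (hW : IsOpen W) (he : chart e ∈ W)
    (hX : IsInfCRAut (modelN ∩ W) X) : ∃ H' : (Fin 5 → ℝ) →L[ℝ] (Fin 4 → ℂ),
      HasFDerivAt (vertPart X) H' e ∧
      H' (fieldP (e 0)) = (4 * (X (chart e) 0).im : ℂ) •
        ![0, 1, 4 * (e 0 : ℂ), 12 * (e 0 : ℂ) ^ 2] ∧
      H' (fieldQ (e 0)) = (-4 * (X (chart e) 0).re : ℂ) •
        ![0, 1, 4 * (e 0 : ℂ), 12 * (e 0 : ℂ) ^ 2] := by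
  obtain ⟨w, hw⟩ := exists_dchart_of_mem (hX.tangent (chart e) (chart_mem_inter he))
  obtain ⟨hP, hQ⟩ := hX.fderiv_chart hW he hw
  have h1 : HasFDerivAt (X ∘ chart) (fderiv ℝ (X ∘ chart) e) e :=
    (hX.toIsVectorField.hasFDerivAt_chart hW he).differentiableAt.hasFDerivAt
  have h2 : HasFDerivAt (fun x => X (chart x) 0) _ e := hasFDerivAt_pi'.1 h1 0
  have h3 : HasFDerivAt crVec _ e := (contDiff_crVec.differentiable (by simp) e).hasFDerivAt
  have h0 : X (chart e) 0 = (w 0 : ℂ) + Complex.I * (w 1 : ℂ) := by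
    rw [hw, dchart_zero_apply]
  have hre : (X (chart e) 0).re = w 0 := by rw [h0]; simp
  have him : (X (chart e) 0).im = w 1 := by rw [h0]; simp
  refine ⟨_, h1.sub (h2.smul h3), ?_, ?_⟩
  · have hv : fderiv ℝ crVec e w - X (chart e) 0 • fderiv ℝ crVec e (fieldP (e 0)) =
        (4 * (X (chart e) 0).im : ℂ) • ![0, 1, 4 * (e 0 : ℂ), 12 * (e 0 : ℂ) ^ 2] := by
      rw [fderiv_crVec_apply, fderiv_crVec_apply, him, h0]
      funext i
      fin_cases i
      · simp
      · simp [fieldP]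
        linear_combination (-4 * (w 1 : ℂ)) * Complex.I_mul_I
      · simp [fieldP]
        linear_combination (-16 * (e 0 : ℂ) * (w 1 : ℂ)) * Complex.I_mul_I
      · simp [fieldP]
        linear_combination (-48 * (e 0 : ℂ) ^ 2 * (w 1 : ℂ)) * Complex.I_mul_I
    rw [← hv]
    simp only [sub_apply, add_apply, smul_apply, ContinuousLinearMap.smulRight_apply,
      ContinuousLinearMap.comp_apply, ContinuousLinearMap.proj_apply]
    linear_combination (norm := module) hP
  · have hv : Complex.I • fderiv ℝ crVec e w - X (chart e) 0 • fderiv ℝ crVec e (fieldQ (e 0)) =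
        (-4 * (X (chart e) 0).re : ℂ) • ![0, 1, 4 * (e 0 : ℂ), 12 * (e 0 : ℂ) ^ 2] := by
      rw [fderiv_crVec_apply, fderiv_crVec_apply, hre, h0]
      funext i
      fin_cases i
      · simp
      · simp [fieldQ]
        linear_combination (4 * (w 0 : ℂ)) * Complex.I_mul_I
      · simp [fieldQ]
        linear_combination (16 * (e 0 : ℂ) * (w 0 : ℂ)) * Complex.I_mul_I
      · simp [fieldQ]
        linear_combination (48 * (e 0 : ℂ) ^ 2 * (w 0 : ℂ)) * Complex.I_mul_I
    rw [← hv]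
    have hQ0 := congrFun hQ 0
    simp only [Pi.smul_apply, smul_eq_mul] at hQ0
    simp only [sub_apply, add_apply, smul_apply, ContinuousLinearMap.smulRight_apply,
      ContinuousLinearMap.comp_apply, ContinuousLinearMap.proj_apply]
    rw [hQ0, hQ]
    linear_combination (norm := module) Complex.I • hP

theorem IsInfCRAut.contDiffOn_vertPart (hX : IsInfCRAut (modelN ∩ W) X) (i : Fin 4) :
    ContDiffOn ℝ ∞ (fun e => (vertPart X e i).re) (chart ⁻¹' W) := by
  have h1 := hX.toIsVectorField.contDiffOn_chart
  have h2 : ContDiffOn ℝ ∞ (fun e => X (chart e) 0) (chart ⁻¹' W) := contDiffOn_pi.1 h1 0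
  have h3 : ContDiffOn ℝ ∞ (vertPart X) (chart ⁻¹' W) :=
    h1.sub (h2.smul contDiff_crVec.contDiffOn)
  exact Complex.reCLM.contDiff.comp_contDiffOn (contDiffOn_pi.1 h3 i)

/-- Every infinitesimal CR automorphism of a connected open subset of `N` is the restriction of
one of the fields `holField θ`. -/
theorem IsInfCRAut.exists_eq_holField (hW : IsOpen W) (hc : IsPreconnected (chart ⁻¹' W))
    (hX : IsInfCRAut (modelN ∩ W) X) : ∃ θ, ∀ p ∈ modelN ∩ W, X p = holField θ p := by
  have hΩ := isOpen_chart_preimage hW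
  have hk := hX.contDiffOn_vertPart
  have hf : ContDiffOn ℝ ∞ (fun e => X (chart e) 0) (chart ⁻¹' W) :=
    contDiffOn_pi.1 hX.toIsVectorField.contDiffOn_chart 0
  have hx : ContDiffOn ℝ ∞ (fun e : Fin 5 → ℝ => e 0) (chart ⁻¹' W) :=
    (contDiff_apply ℝ ℝ 0).contDiffOn
  -- The functions in `sa`, `sb`, `sc` are the coefficients `a, b, c` of the vertical part in the
  -- frame `T, S, R`, obtained by solving the triangular system.
  have sa : ContDiffOn ℝ ∞ (fun e => 1 / 2 * (vertPart X e 1).re) (chart ⁻¹' W) :=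
    contDiffOn_const.mul (hk 1)
  have sb : ContDiffOn ℝ ∞ (fun e => 1 / 4 * (vertPart X e 2).re -
      e 0 * (vertPart X e 1).re) (chart ⁻¹' W) :=
    (contDiffOn_const.mul (hk 2)).sub (hx.mul (hk 1))
  have sc : ContDiffOn ℝ ∞ (fun e => 1 / 12 * (vertPart X e 3).re -
      1 / 2 * (e 0 * (vertPart X e 2).re) + e 0 ^ 2 * (vertPart X e 1).re) (chart ⁻¹' W) :=
    ((contDiffOn_const.mul (hk 3)).sub (contDiffOn_const.mul (hx.mul (hk 2)))).add
      ((hx.pow 2).mul (hk 1))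
  have s1 : ContDiffOn ℝ ∞ (fun e => 2 * (X (chart e) 0).im) (chart ⁻¹' W) :=
    contDiffOn_const.mul (Complex.imCLM.contDiff.comp_contDiffOn hf)
  have s2 : ContDiffOn ℝ ∞ (fun e => -2 * (X (chart e) 0).re) (chart ⁻¹' W) :=
    contDiffOn_const.mul (Complex.reCLM.contDiff.comp_contDiffOn hf)
  have dirP : ∀ {g : (Fin 5 → ℝ) → ℝ} (sg : ContDiffOn ℝ ∞ g (chart ⁻¹' W)) {e}
      (_ : e ∈ chart ⁻¹' W) {g' : (Fin 5 → ℝ) →L[ℝ] ℝ}, HasFDerivAt g g' e →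
      (opP hΩ (restrictFun g sg)).1 e = g' (fieldP (e 0)) := by
    intro g sg e he g' hg
    rw [opP, alongField_apply _ _ _ he, fderiv_restrictFun hΩ _ he, hg.fderiv]
  have dirQ : ∀ {g : (Fin 5 → ℝ) → ℝ} (sg : ContDiffOn ℝ ∞ g (chart ⁻¹' W)) {e}
      (_ : e ∈ chart ⁻¹' W) {g' : (Fin 5 → ℝ) →L[ℝ] ℝ}, HasFDerivAt g g' e →
      (opQ hΩ (restrictFun g sg)).1 e = g' (fieldQ (e 0)) := by
    intro g sg e he g' hg
    rw [opQ, alongField_apply _ _ _ he, fderiv_restrictFun hΩ _ he, hg.fderiv]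
  have dk : ∀ e ∈ chart ⁻¹' W, ∃ k' : Fin 4 → (Fin 5 → ℝ) →L[ℝ] ℝ,
      (∀ i, HasFDerivAt (fun e => (vertPart X e i).re) (k' i) e) ∧
      (∀ i, k' i (fieldP (e 0)) =
        4 * (X (chart e) 0).im * (![0, 1, 4 * e 0, 12 * e 0 ^ 2] : Fin 4 → ℝ) i) ∧
      (∀ i, k' i (fieldQ (e 0)) =
        -4 * (X (chart e) 0).re * (![0, 1, 4 * e 0, 12 * e 0 ^ 2] : Fin 4 → ℝ) i) := by
    intro e he
    obtain ⟨H', h1, h2, h3⟩ := hX.hasFDerivAt_vertPart hW he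
    refine ⟨fun i => Complex.reCLM.comp ((ContinuousLinearMap.proj i).comp H'), fun i =>
      Complex.reCLM.hasFDerivAt.comp e (hasFDerivAt_pi'.1 h1 i), fun i => ?_, fun i => ?_⟩
    · simp only [ContinuousLinearMap.comp_apply, h2]
      fin_cases i <;> simp [← Complex.ofReal_pow]
    · simp only [ContinuousLinearMap.comp_apply, h3]
      fin_cases i <;> simp [← Complex.ofReal_pow]
  have dx := hasFDerivAt_proj 0
  have df : ∀ e ∈ chart ⁻¹' W, ∃ f' : (Fin 5 → ℝ) →L[ℝ] ℂ,
      HasFDerivAt (fun e => X (chart e) 0) f' e ∧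
      f' (fieldQ (e 0)) = Complex.I * f' (fieldP (e 0)) := by
    intro e he
    obtain ⟨w, hw⟩ := exists_dchart_of_mem (hX.tangent (chart e) (chart_mem_inter he))
    have h1 : HasFDerivAt (X ∘ chart) (fderiv ℝ (X ∘ chart) e) e :=
      (hX.toIsVectorField.hasFDerivAt_chart hW he).differentiableAt.hasFDerivAt
    exact ⟨_, hasFDerivAt_pi'.1 h1 0, congrFun (hX.fderiv_chart hW he hw).2 0⟩
  obtain ⟨r, s, t, k₁, k₂, k₃, hsol⟩ := exists_solution_parameters hΩ hc
    (a := restrictFun _ sa) (b := restrictFun _ sb) (c := restrictFun _ sc)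
    (e₁ := restrictFun _ s1) (e₂ := restrictFun _ s2)
    (smoothFun_ext fun e he => by
      obtain ⟨k', h1, h2, h3⟩ := dk e he
      rw [dirP sc he ((((h1 3).const_mul (1 / 12)).sub
        (((dx e).mul (h1 2)).const_mul (1 / 2))).add (((dx e).pow 2).mul (h1 1)))]
      refine Eq.trans ?_ (congrArg ((-2 : ℝ) * ·) (restrictFun_apply sb he)).symm
      simp [h2]
      simp [fieldP]
      ring)
    (smoothFun_ext fun e he => by
      obtain ⟨k', h1, h2, h3⟩ := dk e he
      rw [dirQ sc he ((((h1 3).const_mul (1 / 12)).sub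
        (((dx e).mul (h1 2)).const_mul (1 / 2))).add (((dx e).pow 2).mul (h1 1)))]
      simp [h3]
      simp [fieldQ]
      ring)
    (smoothFun_ext fun e he => by
      obtain ⟨k', h1, h2, h3⟩ := dk e he
      rw [dirP sb he (((h1 2).const_mul (1 / 4)).sub ((dx e).mul (h1 1)))]
      refine Eq.trans ?_ (congrArg ((-2 : ℝ) * ·) (restrictFun_apply sa he)).symm
      simp [h2]
      simp [fieldP]
      ring)
    (smoothFun_ext fun e he => by
      obtain ⟨k', h1, h2, h3⟩ := dk e he
      rw [dirQ sb he (((h1 2).const_mul (1 / 4)).sub ((dx e).mul (h1 1)))]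
      simp [h3]
      simp [fieldQ]
      ring)
    (smoothFun_ext fun e he => by
      obtain ⟨k', h1, h2, h3⟩ := dk e he
      rw [dirP sa he ((h1 1).const_mul (1 / 2)), restrictFun_apply s1 he]
      simp [h2]
      ring)
    (smoothFun_ext fun e he => by
      obtain ⟨k', h1, h2, h3⟩ := dk e he
      rw [dirQ sa he ((h1 1).const_mul (1 / 2)), restrictFun_apply s2 he]
      simp [h3]
      ring)
    (smoothFun_ext fun e he => by
      obtain ⟨f', h1, h2⟩ := df e he
      rw [dirQ s2 he ((Complex.reCLM.hasFDerivAt.comp e h1).const_mul (-2)),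
        dirP s1 he ((Complex.imCLM.hasFDerivAt.comp e h1).const_mul 2)]
      simp [h2])
    (smoothFun_ext fun e he => by
      obtain ⟨f', h1, h2⟩ := df e he
      rw [dirQ s1 he ((Complex.imCLM.hasFDerivAt.comp e h1).const_mul 2)]
      refine Eq.trans ?_ (congrArg (-·)
        (dirP s2 he ((Complex.reCLM.hasFDerivAt.comp e h1).const_mul (-2)))).symm
      simp [h2])
  refine ⟨![r, s, t, k₁, k₂, k₃], fun p hp => ?_⟩
  obtain ⟨e, he, rfl⟩ := exists_chart_eq hp
  obtain ⟨w, hw⟩ := exists_dchart_of_mem (hX.tangent (chart e) hp)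
  have hv := vertPart_eq hw
  obtain ⟨h1, h2, ha, hb, hc'⟩ := hsol e he
  have he' : e ∈ chart ⁻¹' W := he
  rw [restrictFun_apply _ he', hw, dchart_zero_apply] at h1 h2
  rw [restrictFun_apply _ he'] at ha hb hc'
  simp only [hv] at ha hb hc'
  simp [-Complex.ofReal_pow] at h1 h2 ha hb hc'
  rw [hw, holField_chart]
  congr 1
  -- The triangular substitution defining `a, b, c` is undone, giving the chart components of `X`
  -- one at a time.
  have w1 : w 1 = r * e 1 + t := by linarith
  have w0 : w 0 = r * e 0 + s := by linarith
  rw [w1] at ha hb hc'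
  have w2 : w 2 = 2 * r * e 2 - 4 * s * e 1 + k₁ := by linear_combination 2 * ha
  rw [w2] at hb hc'
  have w3 : w 3 = 3 * r * e 3 + 4 * s * e 2 + k₂ := by linear_combination 4 * hb
  rw [w3] at hc'
  have w4 : w 4 = 4 * r * e 4 + 6 * s * e 3 + k₃ := by linear_combination 12 * hc'
  funext i
  fin_cases i
  · exact w0
  · exact w1
  · exact w2
  · exact w3
  · exact w4

end Classification

/-! ### The Lie algebra of the model -/

theorem isPreconnected_chart_preimage {W : Set (Fin 4 → ℂ)} (h : IsPreconnected (modelN ∩ W)) :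
    IsPreconnected (chart ⁻¹' W) := by
  have h' : chart ⁻¹' W = chartInv '' (modelN ∩ W) := by
    ext e
    constructor
    · exact fun he => ⟨chart e, chart_mem_inter he, chartInv_chart e⟩
    · rintro ⟨p, hp, rfl⟩
      change chart (chartInv p) ∈ W
      rw [chart_chartInv hp.1]
      exact hp.2
  rw [h']
  exact h.image _ contDiff_chartInv.continuous.continuousOn

theorem holField_add (θ η : Fin 6 → ℝ) (p : Fin 4 → ℂ) :
    holField (θ + η) p = holField θ p + holField η p := by
  funext i
  fin_cases i <;> simp [holField] <;> ring

theorem holField_smul (c : ℝ) (θ : Fin 6 → ℝ) (p : Fin 4 → ℂ) :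
    holField (c • θ) p = c • holField θ p := by
  funext i
  fin_cases i <;> simp [holField] <;> ring

/-- A field `holField θ` is determined by its restriction to an open subset of `N`. -/
theorem eq_zero_of_holField_eq_zero {W : Set (Fin 4 → ℂ)} (hW : IsOpen W)
    (hne : (modelN ∩ W).Nonempty) {θ : Fin 6 → ℝ}
    (h : ∀ p ∈ modelN ∩ W, holField θ p = 0) : θ = 0 := by
  obtain ⟨p, hp⟩ := hne
  obtain ⟨e, he, rfl⟩ := exists_chart_eq hp
  have h1 : restrictHol W θ ∘ chart =ᶠ[nhds e] fun _ => 0 :=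
    Filter.eventually_of_mem ((isOpen_chart_preimage hW).mem_nhds he) fun x hx =>
      (restrictHol_chart θ hx).trans (h _ (chart_mem_inter hx))
  -- The dilation coefficient is isolated by a derivative along `P`; the values at one point then
  -- determine the other five parameters.
  have h2 := fderiv_restrictHol_chart hW θ he (fieldP (e 0))
  rw [h1.fderiv_eq, dchart_fieldP, fderiv_holField_apply] at h2
  have r0 : θ 0 = 0 := by
    have h := (congrFun h2 0).symm
    simpa [crVec] using h
  have h3 := h _ hp
  have c0 := congrFun h3 0
  simp [holField, r0] at c0
  have r1 : θ 1 = 0 := by simpa using congrArg Complex.re c0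
  have r2 : θ 2 = 0 := by simpa using congrArg Complex.im c0
  have r3 := congrFun h3 1
  have r4 := congrFun h3 2
  have r5 := congrFun h3 3
  simp [holField, r0, r1, r2] at r3 r4 r5
  funext i
  fin_cases i
  · exact r0
  · exact r1
  · exact r2
  · exact r3
  · exact r4
  · exact r5

/-! ### Parametrization of the algebra and its brackets -/

/-- The infinitesimal CR automorphism of `N` with parameters `θ`. -/
noncomputable def autField : (Fin 6 → ℝ) →ₗ[ℝ] autCR modelN where
  toFun θ := ⟨modelN.indicator (holField θ), by
    have h := isInfCRAut_restrictHol isOpen_univ θ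
    rwa [restrictHol, Set.inter_univ] at h⟩
  map_add' θ η := Subtype.ext <| by
    funext p
    by_cases hp : p ∈ modelN
    · simp [hp, holField_add]
    · simp [hp]
  map_smul' c θ := Subtype.ext <| by
    funext p
    by_cases hp : p ∈ modelN
    · simp [hp, holField_smul]
    · simp [hp]

theorem autField_apply (θ : Fin 6 → ℝ) {p : Fin 4 → ℂ} (hp : p ∈ modelN) :
    (autField θ).1 p = holField θ p :=
  Set.indicator_of_mem hp _

theorem autField_injective : Function.Injective autField := by
  rw [injective_iff_map_eq_zero]
  intro θ h
  refine eq_zero_of_holField_eq_zero isOpen_univ ⟨chart 0, chart_mem 0, trivial⟩ fun p hp => ?_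
  rw [← autField_apply θ hp.1, h]
  rfl

theorem autField_surjective : Function.Surjective autField := by
  intro X
  have hX : IsInfCRAut (modelN ∩ Set.univ) X.1 := by
    rw [Set.inter_univ]
    exact X.2
  obtain ⟨θ, hθ⟩ := hX.exists_eq_holField isOpen_univ (by
    rw [Set.preimage_univ]
    exact isPreconnected_univ)
  refine ⟨θ, Subtype.ext <| funext fun p => ?_⟩
  by_cases hp : p ∈ modelN
  · rw [autField_apply θ hp, hθ p ⟨hp, trivial⟩]
  · exact (Set.indicator_of_notMem hp _).trans (X.2.zero_off p hp).symm

/-- The parametrization of `aut_CR(N)`. -/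
noncomputable def autEquiv : (Fin 6 → ℝ) ≃ₗ[ℝ] autCR modelN :=
  LinearEquiv.ofBijective autField ⟨autField_injective, autField_surjective⟩

theorem autEquiv_apply (θ : Fin 6 → ℝ) : autEquiv θ = autField θ := rfl

/-- The Lie bracket of `aut_CR(N)` in the parameters. -/
def structureBracket (θ η : Fin 6 → ℝ) : Fin 6 → ℝ :=
  ![0, -(θ 0 * η 1 - θ 1 * η 0), -(θ 0 * η 2 - θ 2 * η 0),
    -2 * (θ 0 * η 3 - θ 3 * η 0) + 4 * (θ 1 * η 2 - θ 2 * η 1),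
    -3 * (θ 0 * η 4 - θ 4 * η 0) - 4 * (θ 1 * η 3 - θ 3 * η 1),
    -4 * (θ 0 * η 5 - θ 5 * η 0) - 6 * (θ 1 * η 4 - θ 4 * η 1)]

theorem lieBracket_holField (θ η : Fin 6 → ℝ) (p : Fin 4 → ℂ) :
    VectorField.lieBracket ℝ (holField θ) (holField η) p = holField (structureBracket θ η) p := by
  rw [VectorField.lieBracket, fderiv_holField_apply, fderiv_holField_apply]
  funext i
  fin_cases i
  · simp [holField, structureBracket]
    ring
  · simp [holField, structureBracket]
    linear_combination (2 * ((η 1 : ℂ) * θ 2 - θ 1 * η 2)) * Complex.I_mul_I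
  · simp [holField, structureBracket]
    linear_combination (4 * p 0 * ((η 1 : ℂ) * θ 2 - θ 1 * η 2)) * Complex.I_mul_I
  · simp [holField, structureBracket]
    linear_combination (6 * p 0 ^ 2 * ((η 1 : ℂ) * θ 2 - θ 1 * η 2)) * Complex.I_mul_I

theorem lie_autEquiv (θ η : Fin 6 → ℝ) :
    ⁅autEquiv θ, autEquiv η⁆ = autEquiv (structureBracket θ η) := by
  refine Subtype.ext <| funext fun p => ?_
  change bracket modelN (autField θ).1 (autField η).1 p = (autField (structureBracket θ η)).1 p
  by_cases hp : p ∈ modelN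
  · rw [bracket_eq_lieBracket (autField θ).2.toIsVectorField (autField η).2.toIsVectorField
      (contDiff_holField θ) (contDiff_holField η) (fun x hx => autField_apply θ hx)
      (fun x hx => autField_apply η hx) hp, lieBracket_holField, autField_apply _ hp]
  · rw [bracket_zero_off hp]
    exact (Set.indicator_of_notMem hp _).symm

/-! ### Maurer–Cartan forms and structure equations -/

/-- The coordinate forms on `aut_CR(N)`. -/
noncomputable def coordForm (i : Fin 6) : autCR modelN →ₗ[ℝ] ℂ :=
  (Complex.ofRealCLM : ℝ →ₗ[ℝ] ℂ) ∘ₗ LinearMap.proj i ∘ₗ autEquiv.symm.toLinearMap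

theorem coordForm_autEquiv (i : Fin 6) (θ : Fin 6 → ℝ) : coordForm i (autEquiv θ) = (θ i : ℂ) := by
  simp [coordForm]

/-- The normalized Maurer-Cartan forms `τ, σ, ρ, ζ, ζbar, α`. -/
noncomputable def mcForms : Fin 6 → (autCR modelN →ₗ[ℝ] ℂ) :=
  -- Since `i ζ ∧ ζbar = 2 θ₁ ∧ θ₂` and `dθ₃` contains `-4 θ₁ ∧ θ₂`, the factor of `θ₃` is `-1/2`.
  -- The terms `4 θ₁ ∧ θ₃` of `dθ₄` and `6 θ₁ ∧ θ₄` of `dθ₅` then force `1/4` and `-1/12`.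
  ![(-1 / 12 : ℂ) • coordForm 5, (1 / 4 : ℂ) • coordForm 4, (-1 / 2 : ℂ) • coordForm 3,
    coordForm 1 + Complex.I • coordForm 2, coordForm 1 - Complex.I • coordForm 2, coordForm 0]

theorem mcForms_combination (c : Fin 6 → ℂ) (θ : Fin 6 → ℝ) :
    (∑ i, c i • mcForms i) (autEquiv θ) =
      c 0 * (-1 / 12 * θ 5) + c 1 * (1 / 4 * θ 4) + c 2 * (-1 / 2 * θ 3) +
        c 3 * (θ 1 + Complex.I * θ 2) + c 4 * (θ 1 - Complex.I * θ 2) + c 5 * θ 0 := by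
  simp [Fin.sum_univ_succ, mcForms, coordForm_autEquiv]
  ring

theorem linearIndependent_mcForms : LinearIndependent ℂ mcForms := by
  rw [Fintype.linearIndependent_iff]
  intro c hc
  have h : ∀ θ : Fin 6 → ℝ, c 0 * (-1 / 12 * (θ 5 : ℝ)) + c 1 * (1 / 4 * (θ 4 : ℝ)) +
      c 2 * (-1 / 2 * (θ 3 : ℝ)) + c 3 * ((θ 1 : ℝ) + Complex.I * (θ 2 : ℝ)) +
      c 4 * ((θ 1 : ℝ) - Complex.I * (θ 2 : ℝ)) + c 5 * (θ 0 : ℝ) = 0 := fun θ => by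
    rw [← mcForms_combination, hc]
    rfl
  have h0 := h ![1, 0, 0, 0, 0, 0]
  have h1 := h ![0, 1, 0, 0, 0, 0]
  have h2 := h ![0, 0, 1, 0, 0, 0]
  have h3 := h ![0, 0, 0, 1, 0, 0]
  have h4 := h ![0, 0, 0, 0, 1, 0]
  have h5 := h ![0, 0, 0, 0, 0, 1]
  simp at h0 h1 h2 h3 h4 h5
  have h34 : c 3 = c 4 := by
    linear_combination (-Complex.I) * h2 + (c 3 - c 4) * Complex.I_mul_I
  rw [h34] at h1
  have h4' : c 4 = 0 := by linear_combination (1 / 2 : ℂ) * h1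
  intro i
  fin_cases i
  · exact h5
  · exact h4
  · exact h3
  · exact h34.trans h4'
  · exact h4'
  · exact h0

theorem span_mcForms : Submodule.span ℂ (Set.range mcForms) = ⊤ := by
  rw [eq_top_iff]
  intro φ _
  rw [Submodule.mem_span_range_iff_exists_fun]
  let f : Fin 6 → ℂ := fun i => φ (autEquiv (Pi.single i 1))
  -- The normalizations are inverted, with `θ₁ = (ζ + ζbar)/2` and `θ₂ = (ζ - ζbar)/(2i)`.
  refine ⟨![-12 * f 5, 4 * f 4, -2 * f 3, (f 1 - Complex.I * f 2) / 2,
    (f 1 + Complex.I * f 2) / 2, f 0], LinearMap.ext fun X => ?_⟩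
  obtain ⟨θ, rfl⟩ := autEquiv.surjective X
  have h : φ (autEquiv θ) = ∑ i, (θ i : ℂ) * f i := by
    have h' := LinearMap.pi_apply_eq_sum_univ (φ ∘ₗ autEquiv.toLinearMap) θ
    refine h'.trans (Finset.sum_congr rfl fun i _ => ?_)
    simp only [Complex.real_smul, f]
    have hi : (fun j => if i = j then (1 : ℝ) else 0) = Pi.single i 1 := by
      funext j
      simp [Pi.single_apply, eq_comm]
    rw [hi]
    rfl
  rw [mcForms_combination, h]
  simp [Fin.sum_univ_succ]
  linear_combination (-(f 2 * θ 2)) * Complex.I_mul_I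

theorem exists_maurerCartan_forms :
    ∃ τ σ ρ ζ ζbar α : autCR modelN →ₗ[ℝ] ℂ,
      LinearIndependent ℂ ![τ, σ, ρ, ζ, ζbar, α] ∧
      Submodule.span ℂ (Set.range ![τ, σ, ρ, ζ, ζbar, α]) = ⊤ ∧
      IsRealForm τ ∧ IsRealForm σ ∧ IsRealForm ρ ∧
      IsRealForm α ∧ (∀ X, ζbar X = conj (ζ X)) ∧
      mcDeriv τ = (4 : ℂ) • wedge α τ + wedge σ ζ + wedge σ ζbar ∧
      mcDeriv σ = (3 : ℂ) • wedge α σ + wedge ρ ζ + wedge ρ ζbar ∧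
      mcDeriv ρ = (2 : ℂ) • wedge α ρ + Complex.I • wedge ζ ζbar ∧
      mcDeriv ζ = wedge α ζ ∧
      mcDeriv ζbar = wedge α ζbar ∧
      mcDeriv α = 0 := by
  have ext2 : ∀ {F G : autCR modelN → autCR modelN → ℂ},
      (∀ θ η, F (autEquiv θ) (autEquiv η) = G (autEquiv θ) (autEquiv η)) → F = G := by
    intro F G h
    funext X Y
    obtain ⟨θ, rfl⟩ := autEquiv.surjective X
    obtain ⟨η, rfl⟩ := autEquiv.surjective Y
    exact h θ η
  refine ⟨_, _, _, _, _, _, linearIndependent_mcForms, span_mcForms, ?_, ?_, ?_, ?_, ?_,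
    ext2 fun θ η => ?_, ext2 fun θ η => ?_, ext2 fun θ η => ?_, ext2 fun θ η => ?_,
    ext2 fun θ η => ?_, ext2 fun θ η => ?_⟩
  · intro X
    obtain ⟨θ, rfl⟩ := autEquiv.surjective X
    simp [coordForm_autEquiv, Complex.conj_ofNat]
  · intro X
    obtain ⟨θ, rfl⟩ := autEquiv.surjective X
    simp [coordForm_autEquiv, Complex.conj_ofNat]
  · intro X
    obtain ⟨θ, rfl⟩ := autEquiv.surjective X
    simp [coordForm_autEquiv, Complex.conj_ofNat]
  · intro X
    obtain ⟨θ, rfl⟩ := autEquiv.surjective X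
    simp [coordForm_autEquiv]
  · intro X
    obtain ⟨θ, rfl⟩ := autEquiv.surjective X
    simp [coordForm_autEquiv, sub_eq_add_neg]
  · simp [mcDeriv, wedge, lie_autEquiv, coordForm_autEquiv, structureBracket]
    ring
  · simp [mcDeriv, wedge, lie_autEquiv, coordForm_autEquiv, structureBracket]
    ring
  · simp [mcDeriv, wedge, lie_autEquiv, coordForm_autEquiv, structureBracket]
    linear_combination (2 * ((θ 1 : ℂ) * η 2 - θ 2 * η 1)) * Complex.I_mul_I
  · simp [mcDeriv, wedge, lie_autEquiv, coordForm_autEquiv, structureBracket]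
    ring
  · simp [mcDeriv, wedge, lie_autEquiv, coordForm_autEquiv, structureBracket]
    ring
  · simp [mcDeriv, lie_autEquiv, coordForm_autEquiv, structureBracket]

/-- The local classification already produces a globally defined polynomial field; uniqueness holds
because such a field is determined by its restriction to a non-empty open part of `N`. -/
theorem existsUnique_extension {W : Set (Fin 4 → ℂ)} (hW : IsOpen W)
    (hc : IsConnected (modelN ∩ W)) {Y : (Fin 4 → ℂ) → (Fin 4 → ℂ)}
    (hY : Y ∈ autCR (modelN ∩ W)) :
    ∃! X : autCR modelN, ∀ p ∈ modelN ∩ W, X.1 p = Y p := by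
  obtain ⟨θ, hθ⟩ := IsInfCRAut.exists_eq_holField hW
    (isPreconnected_chart_preimage hc.isPreconnected) hY
  refine ⟨autEquiv θ, fun p hp => ?_, fun X hX => ?_⟩
  · rw [hθ p hp, autEquiv_apply, autField_apply θ hp.1]
  · obtain ⟨η, rfl⟩ := autEquiv.surjective X
    congr 1
    rw [← sub_eq_zero]
    refine eq_zero_of_holField_eq_zero hW hc.nonempty fun p hp => ?_
    have h := hX p hp
    rw [hθ p hp] at h
    rw [← autField_apply _ hp.1, map_sub]
    change (autField η).1 p - (autField θ).1 p = 0
    rw [sub_eq_zero, autField_apply θ hp.1]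
    exact h

end CRModel

theorem theorem2 :
    Module.finrank ℝ (CRModel.autCR CRModel.modelN) = 6 ∧
    (∃ τ σ ρ ζ ζbar α : CRModel.autCR CRModel.modelN →ₗ[ℝ] ℂ,
      LinearIndependent ℂ ![τ, σ, ρ, ζ, ζbar, α] ∧
      Submodule.span ℂ (Set.range ![τ, σ, ρ, ζ, ζbar, α]) = ⊤ ∧
      CRModel.IsRealForm τ ∧ CRModel.IsRealForm σ ∧ CRModel.IsRealForm ρ ∧
      CRModel.IsRealForm α ∧ (∀ X, ζbar X = (starRingEnd ℂ) (ζ X)) ∧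
      CRModel.mcDeriv τ =
        (4 : ℂ) • CRModel.wedge α τ + CRModel.wedge σ ζ + CRModel.wedge σ ζbar ∧
      CRModel.mcDeriv σ =
        (3 : ℂ) • CRModel.wedge α σ + CRModel.wedge ρ ζ + CRModel.wedge ρ ζbar ∧
      CRModel.mcDeriv ρ = (2 : ℂ) • CRModel.wedge α ρ + Complex.I • CRModel.wedge ζ ζbar ∧
      CRModel.mcDeriv ζ = CRModel.wedge α ζ ∧
      CRModel.mcDeriv ζbar = CRModel.wedge α ζbar ∧
      CRModel.mcDeriv α = 0) ∧
    (∀ W : Set (Fin 4 → ℂ), IsOpen W → IsConnected (CRModel.modelN ∩ W) →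
      ∀ Y ∈ CRModel.autCR (CRModel.modelN ∩ W),
        ∃! X : CRModel.autCR CRModel.modelN, ∀ p ∈ CRModel.modelN ∩ W, X.1 p = Y p) := by
  refine ⟨?_, CRModel.exists_maurerCartan_forms, fun W hW hc Y hY =>
    CRModel.existsUnique_extension hW hc hY⟩
  rw [← CRModel.autEquiv.finrank_eq, Module.finrank_fin_fun]
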